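/- **Conventions.** Let $D$ be a digraph with vertex set $V$ (loops and parallel edges are allowed). For $x,y\in V$ let $d(x,y)\in[0,\infty]$ be the length of a shortest directed path from $x$ to $y$ ($\infty$ if there is none), and let $d^{\leftrightarrow}(x,y)=\min\{d(x,y),d(y,x)\}$; for a directed path $P$ let $d^{\leftrightarrow}(s,P)$ be the minimum of $d^{\leftrightarrow}(s,v)$ over the vertices $v$ of $P$. A *geodesic* from $x$ to $y$ is a directed path from $x$ to $y$ of length $d(x,y)$. For $r\ge 0$ let $\mathcal B^+_r(x)=\{y: d(x,y)\le r\}$, $\mathcal B^-_r(x)=\{y: d(y,x)\le r\}$; balls around a set of vertices are the unions of the balls around its elements. * $D$ is *locally finite* if for every $x$ there are only finitely many $y$ with $d(x,y)=1$ and only finitely many $y$ with $d(y,x)=1$. * $D$ is *$\delta$-hyperbolic* if for all vertices $a,b,c$ and all geodesics $P$ from $a$ to $b$, $Q$ between $a$ and $c$, and $R$ between $b$ and $c$ ($Q$ and $R$ in either direction), every vertex of $P$ lies in $\mathcal B^+_\delta(Q)\cup\mathcal B^-_\delta(R)$. * $D$ satisfies (B1) (respectively (B2)) for $f\colon\mathbb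 R\to\mathbb R$ if for all $x\in V$, $r\ge0$ and all $y,z\in\mathcal B^+_r(x)$ (respectively $y,z\in\mathcal B^-_r(x)$) either $d(y,z)=\infty$ or $d(y,z)\le f(r)$. * A finite set $S\subseteq V$ is a *finite base* if every $x\in V$ has some $s\in S$ with $d^{\leftrightarrow}(x,s)<\infty$. * A *ray* (*anti-ray*) is a sequence $R=(R(i))_{i\in\mathbb N}$ of distinct vertices with edges from $R(i)$ to $R(i+1)$ (from $R(i+1)$ to $R(i)$) for all $i$. It is *quasi-geodesic* if there are $\gamma\ge1$, $c\ge0$ such that for all $i\le j$ we have $j-i\le\gamma\, d(R(i),R(j))+c$ (for anti-rays: $j-i\le\gamma\, d(R(j),R(i))+c$). * For rays or anti-rays write $R_1\preccurlyeq R_2$ if there are infinitely many pairwise disjoint directed paths from $R_1$ to $R_2$. The *ends* of $D$ are the equivalence classes of the relation $R_1\preccurlyeq R_2\preccurlyeq R_1$ on the set of all rays and anti-rays. * For quasi-geodesic rays or anti-rays write $R_1\le R_2$ if there is $M\ge0$ such that for all $x\in V$, $r\ge0$ there is a directed path from $R_1$ to $R_2$ of length at most $M$ with no vertex in $\mathcal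 B^+_r(x)\cup\mathcal B^-_r(x)$. The *quasi-geodesic boundary* $\partial D$ is the set of equivalence classes of $R_1\le R_2\le R_1$ on the set of quasi-geodesic rays and anti-rays. A point $\eta\in\partial D$ *lies in* the end $\omega$ if $\eta\subseteq\omega$. * Let $S$ be a finite base and $\varepsilon>0$. A vertex $x$ is represented by the constant sequence $x$, and $\eta\in\partial D$ by the sequences $(R(i))_i$ with $R\in\eta$. For $s\in S$ and $\eta,\mu\in D\cup\partial D$ (that is, $V\cup\partial D$) let $\rho_s^\varepsilon(\eta,\mu)$ be the infimum of $$\exp\bigl(-\varepsilon\liminf\{d^{\leftrightarrow}(s,P) : i,j\to\infty,\ P\text{ a geodesic from }a_i\text{ to }b_j\}\bigr)\qquad(e^{-\infty}=0)$$ over the representing sequences $a$ of $\eta$ and $b$ of $\mu$ such that geodesics from $a_i$ to $b_j$ exist for arbitrarily large $i,j$ (and $\rho_s^\varepsilon(\eta,\mu)=\infty$ if there are no such $a,b$). Put $\rho_S^\varepsilon=\max_{s\in S}\rho_s^\varepsilon$ and $$d_{S,\varepsilon}(\eta,\mu)=\inf\Bigl\{\sum_{i=0}^{n-1}\rho_S^\varepsilon(\eta_i,\eta_{i+1})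 : n\ge 0,\ \eta=\eta_0,\dots,\eta_n=\mu\in D\cup\partial D\Bigr\}.$$ * A *semimetric* on $X$ is a map $d\colon X\times X\to[0,\infty]$ that satisfies the triangle inequality and $d(x,y)=0\iff x=y$ (symmetry is not required). Its forward (backward) topology is generated by the sets $\{y: d(x,y)<r\}$ (respectively $\{y: d(y,x)<r\}$). $X$ is *semiconnected* if it has no partition into two nonempty sets each of which is open in both topologies; a subset is semiconnected if it is so with the restricted semimetric, and a *semiconnected component* is a maximal semiconnected subset. **Theorem.** Let $\delta\ge0$ and let $D$ be a locally finite $\delta$-hyperbolic digraph that satisfies (B1) and (B2) for a function $f\colon\mathbb R\to\mathbb R$ and that has a finite base $S$. Let $\varepsilon>0$ be such that $e^{2\varepsilon(6\delta+2\delta f(\delta+1))}<\sqrt2$. If $d_{S,\varepsilon}$ is a semimetric on $D\cup\partial D$, then for every end $\omega$ of $D$ there is a unique semiconnected component of $(\partial D,d_{S,\varepsilon})$ that contains all boundary points lying in $\omega$. -/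

import Mathlib

open scoped ENNReal NNReal

/-! ### Semimetric spaces: the two topologies and semiconnectedness -/

namespace Semimetric

universe u

variable {X : Type u}

/-- A semimetric: a map to `[0,∞]` with the triangle inequality, not necessarily symmetric, that
vanishes exactly at the pairs `(x, x)`. -/
def IsSemimetric (d : X → X → ℝ≥0∞) : Prop :=
  (∀ x y, d x y = 0 ↔ x = y) ∧ ∀ x y z, d x y ≤ d x z + d z y

/-- The forward topology, generated by the open out-balls. -/
abbrev forwardTopology (d : X → X → ℝ≥0∞) : TopologicalSpace X :=
  TopologicalSpace.generateFrom {U | ∃ (x : X) (r : ℝ≥0), U = {y | d x y < r}}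

/-- The backward topology, generated by the open in-balls. -/
abbrev backwardTopology (d : X → X → ℝ≥0∞) : TopologicalSpace X :=
  TopologicalSpace.generateFrom {U | ∃ (x : X) (r : ℝ≥0), U = {y | d y x < r}}

/-- `U` is open both in the forward and in the backward topology. -/
def IsBiopen (d : X → X → ℝ≥0∞) (U : Set X) : Prop :=
  (forwardTopology d).IsOpen U ∧ (backwardTopology d).IsOpen U

/-- A space is semiconnected if it has no partition into two (nonempty) sets that are both open
in both topologies. -/
def IsSemiconnectedSpace (d : X → X → ℝ≥0∞) : Prop :=
  ¬ ∃ U W : Set X, U.Nonempty ∧ W.Nonempty ∧ Disjoint U W ∧ U ∪ W = Set.univ ∧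
    IsBiopen d U ∧ IsBiopen d W

/-- A subset is semiconnected if it is so as a space with the restricted distance. -/
def IsSemiconnected (d : X → X → ℝ≥0∞) (C : Set X) : Prop :=
  IsSemiconnectedSpace (fun x y : C => d x y)

/-- A semiconnected component: a maximal semiconnected subset. -/
def IsSemiconnectedComponent (d : X → X → ℝ≥0∞) (C : Set X) : Prop :=
  Maximal (IsSemiconnected d) C

end Semimetric

/-! ### Digraphs

A digraph (loops and parallel edges allowed) is a `Quiver V`; a finite directed path is a
`Quiver.Path`, repeated vertices allowed. -/

namespace HypDigraph

open Quiver

universe u v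

section

variable {V : Type u} [Quiver.{v} V]

/-- The length of a shortest directed path from `x` to `y`, and `∞` if there is none. -/
noncomputable def dist (x y : V) : ℝ≥0∞ := ⨅ p : Path x y, (p.length : ℝ≥0∞)

/-- `min (d x y) (d y x)`. -/
noncomputable def minDist (x y : V) : ℝ≥0∞ := min (dist x y) (dist y x)

/-- The distance `minDist` from a vertex `s` to the nearest vertex on the path `p`. -/
noncomputable def minDistPath (s : V) {x y : V} (p : Path x y) : ℝ≥0∞ :=
  ⨅ v ∈ p.vertices, minDist s v

def IsGeodesic {x y : V} (p : Path x y) : Prop := (p.length : ℝ≥0∞) = dist x y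

def outBall (r : ℝ) (x : V) : Set V := {y | dist x y ≤ ENNReal.ofReal r}

def inBall (r : ℝ) (x : V) : Set V := {y | dist y x ≤ ENNReal.ofReal r}

variable (V) in
/-- All out-degrees and in-degrees are finite. -/
def LocallyFinite : Prop :=
  ∀ x : V, {y : V | dist x y = 1}.Finite ∧ {y : V | dist y x = 1}.Finite

/-- `T` is the vertex set of a geodesic from `x` to `y` or of a geodesic from `y` to `x`. -/
def IsSide (x y : V) (T : Set V) : Prop :=
  (∃ p : Path x y, IsGeodesic p ∧ T = {v | v ∈ p.vertices}) ∨
    (∃ p : Path y x, IsGeodesic p ∧ T = {v | v ∈ p.vertices})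

variable (V) in
/-- All geodesic triangles are `δ`-thin: if `P` is a side from `a` to `b`, if `Q` is the side
between `a` and `c` and `R` is the side between `b` and `c`, these two in either direction, then
`P` lies in the union of the out-ball of radius `δ` around `Q` and the in-ball of radius `δ`
around `R`. -/
def IsHyperbolic (δ : ℝ) : Prop :=
  ∀ (a b c : V) (P : Path a b), IsGeodesic P →
    ∀ Q R : Set V, IsSide a c Q → IsSide b c R →
      ∀ v ∈ P.vertices, (∃ q ∈ Q, v ∈ outBall δ q) ∨ (∃ r ∈ R, v ∈ inBall δ r)

variable (V) in
/-- Finite distances inside the out-balls of radius `r` are bounded by `f r`. -/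
def SatisfiesB1 (f : ℝ → ℝ) : Prop :=
  ∀ (x : V) (r : ℝ), 0 ≤ r → ∀ y ∈ outBall r x, ∀ z ∈ outBall r x,
    dist y z = ⊤ ∨ (dist y z).toReal ≤ f r

variable (V) in
/-- Finite distances inside the in-balls of radius `r` are bounded by `f r`. -/
def SatisfiesB2 (f : ℝ → ℝ) : Prop :=
  ∀ (x : V) (r : ℝ), 0 ≤ r → ∀ y ∈ inBall r x, ∀ z ∈ inBall r x,
    dist y z = ⊤ ∨ (dist y z).toReal ≤ f r

/-- `S` is a base: every vertex reaches or is reached from an element of `S`. -/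
def IsBase (S : Finset V) : Prop := ∀ x : V, ∃ s ∈ S, minDist x s < ⊤

/-! ### Rays, anti-rays and ends -/

variable (V) in
/-- A ray (`anti = false`, edges from `vert i` to `vert (i + 1)`) or an anti-ray (`anti = true`,
edges from `vert (i + 1)` to `vert i`), in both cases with pairwise distinct vertices. -/
structure Ray where
  anti : Bool
  vert : ℕ → V
  injective : Function.Injective vert
  edge : ∀ i, if anti then Nonempty (vert (i + 1) ⟶ vert i) else Nonempty (vert i ⟶ vert (i + 1))

/-- There are infinitely many pairwise disjoint directed paths from `R₁` to `R₂`. -/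
def EndLE (R₁ R₂ : Ray V) : Prop :=
  ∃ (i j : ℕ → ℕ) (p : ∀ n, Path (R₁.vert (i n)) (R₂.vert (j n))),
    ∀ m n, m ≠ n → ∀ v ∈ (p m).vertices, v ∉ (p n).vertices

def EndEquiv (R₁ R₂ : Ray V) : Prop := EndLE R₁ R₂ ∧ EndLE R₂ R₁

variable (V) in
/-- The ends: the equivalence classes of `EndEquiv`. -/
def ends : Set (Set (Ray V)) := {ω | ∃ R : Ray V, ω = {R' | EndEquiv R R'}}

/-! ### The quasi-geodesic boundary -/

/-- Every finite directed subpath, which has length `j - i`, is a `(γ, c)`-quasi-geodesic, for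
some `γ ≥ 1` and `c ≥ 0`. -/
def Ray.IsQuasiGeodesic (R : Ray V) : Prop :=
  ∃ γ c : ℝ, 1 ≤ γ ∧ 0 ≤ c ∧ ∀ i j : ℕ, i ≤ j →
    ((j : ℝ) - i) ≤
      γ * (if R.anti then dist (R.vert j) (R.vert i) else dist (R.vert i) (R.vert j)).toReal + c

/-- For some `M`, there are directed paths of length at most `M` from `R₁` to `R₂` outside of all
the sets `outBall r x ∪ inBall r x`. -/
def BoundaryLE (R₁ R₂ : Ray V) : Prop :=
  ∃ M : ℝ, 0 ≤ M ∧ ∀ (r : ℝ) (x : V), 0 ≤ r →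
    ∃ (i j : ℕ) (p : Path (R₁.vert i) (R₂.vert j)), (p.length : ℝ) ≤ M ∧
      ∀ v ∈ p.vertices, v ∉ outBall r x ∪ inBall r x

def BoundaryEquiv (R₁ R₂ : Ray V) : Prop := BoundaryLE R₁ R₂ ∧ BoundaryLE R₂ R₁

variable (V) in
/-- The quasi-geodesic boundary: the equivalence classes of `BoundaryEquiv` on the set of
quasi-geodesic rays and anti-rays. -/
def Boundary : Type u :=
  {η : Set (Ray V) // ∃ R : Ray V, R.IsQuasiGeodesic ∧
    η = {R' | R'.IsQuasiGeodesic ∧ BoundaryEquiv R R'}}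

/-- The boundary points that lie in the end `ω`, i.e. the preimage of `ω` under the canonical map
from the boundary to the ends. -/
def pointsIn (ω : Set (Ray V)) : Set (Boundary V) := {η | η.1 ⊆ ω}

/-! ### The distance on the union of the digraph and its boundary -/

variable (V) in
/-- The union of the vertex set and the boundary. -/
abbrev WithBoundary : Type u := V ⊕ Boundary V

/-- The sequences that stand for a point: the constant sequence for a vertex, the vertex sequences
of all its rays and anti-rays for a boundary point. -/
def approach : WithBoundary V → Set (ℕ → V)
  | Sum.inl x => {fun _ => x}
  | Sum.inr η => {a | ∃ R ∈ η.1, a = R.vert}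

/-- There are geodesics from `a i` to `b j` for arbitrarily large `i` and `j`. -/
def Linked (a b : ℕ → V) : Prop :=
  ∀ N : ℕ, ∃ i ≥ N, ∃ j ≥ N, Nonempty (Path (a i) (b j))

/-- The limit inferior of the distances of `s` to the geodesics from `a i` to `b j`, as `i` and
`j` tend to infinity. -/
noncomputable def geodLiminf (s : V) (a b : ℕ → V) : ℝ≥0∞ :=
  ⨆ N : ℕ, ⨅ (i : ℕ) (_ : N ≤ i) (j : ℕ) (_ : N ≤ j) (p : Path (a i) (b j)) (_ : IsGeodesic p),
    minDistPath s p

/-- `exp (-ε t)`, with value `0` at `t = ∞`. -/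
noncomputable def expNeg (ε : ℝ) (t : ℝ≥0∞) : ℝ≥0∞ :=
  if t = ⊤ then 0 else ENNReal.ofReal (Real.exp (-ε * t.toReal))

/-- The function `ρ_s^ε`. It is `∞` if there are no geodesics from `η` to `μ`. -/
noncomputable def rhoAt (ε : ℝ) (s : V) (η μ : WithBoundary V) : ℝ≥0∞ :=
  ⨅ (a : ℕ → V) (_ : a ∈ approach η) (b : ℕ → V) (_ : b ∈ approach μ) (_ : Linked a b),
    expNeg ε (geodLiminf s a b)

/-- The function `ρ_S^ε`. -/
noncomputable def rho (ε : ℝ) (S : Finset V) (η μ : WithBoundary V) : ℝ≥0∞ :=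
  ⨆ s ∈ S, rhoAt ε s η μ

/-- The pseudo-semimetric `d_{S,ε}`: the infimum of the `ρ_S^ε`-lengths of the finite chains
`η = c 0, c 1, …, c n = μ`, where `n = 0` is allowed if `η = μ`. -/
noncomputable def visualDist (ε : ℝ) (S : Finset V) (η μ : WithBoundary V) : ℝ≥0∞ :=
  ⨅ (n : ℕ) (c : ℕ → WithBoundary V) (_ : c 0 = η) (_ : c n = μ),
    ∑ i ∈ Finset.range n, rho ε S (c i) (c (i + 1))

/-- The restriction of `d_{S,ε}` to the boundary. -/
noncomputable def boundaryDist (ε : ℝ) (S : Finset V) (η μ : Boundary V) : ℝ≥0∞ :=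
  visualDist ε S (Sum.inr η) (Sum.inr μ)

end

end HypDigraph

/-! A nonempty semiconnected set lies in exactly one semiconnected component: the union of all
semiconnected sets containing it (`existsUnique_semiconnectedComponent`). So it is enough that the
boundary points in an end form a nonempty semiconnected set. Two cases arise, according to whether a
ray `R₀` of the end has a tail in a single strong component; this property passes to equivalent rays
(`ReachLE.eventually_strong`).

Without such a component, a vertex cannot lie on walks from late vertices of one ray of the end to
late vertices of another for arbitrarily late choices, for it would then be strongly connected to a
tail. Hence geodesics between the two rays leave every finite set, the distance of their boundary
points is 0, and the end contains at most one point (`pointsIn_subsingleton_of_no_strong`). A limit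
of geodesics along `R₀` provides one (`exists_geodesic_ray`).

In the other case let `o` be a vertex of the component. By (B1) ways back have bounded length, so
inside the component thinness of triangles holds for the mutual distance, as in an undirected
hyperbolic graph (`Thin.mut`). Three facts carry the argument. Vertices of the component that escape
along far chains attached to a ray of the end accumulate at a boundary point of that end,
represented by a limit of geodesics from `o` (`exists_boundary_limit`). A quasi-geodesic ray of the
end has vertices arbitrarily close to its boundary point: repeated halving shows that sides between
its vertices deviate from it only logarithmically, while its vertices recede linearly from `o`
(`exists_vert_close`). Two such rays are joined, for every radius, by chains of adjacent vertices
outside the ball of this radius around `o` (`exists_farChain_between`), and a step of such a chain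
is short in the visual distance if the radius is large.

Suppose now that a set `T` and its complement split the points of the end. Along a chain from a
vertex near a point of `T` to a vertex near a point outside, some step switches from being nearer to
`T` to not being nearer. As the radius grows, these steps accumulate at a boundary point of the end
that has points of both parts arbitrarily close to it, a contradiction
(`isSemiconnected_pointsIn_of_strong`). -/

namespace HypDigraph

open Filter

/-! ### Step systems

`L n x y` stands for the existence of a directed walk of length at most `n` from `x` to `y`. -/

/-- The laws of the relations "there is a directed walk of length at most `n` from `x` to `y`" in
a locally finite digraph. -/
structure StepSystem {V : Type*} (L : ℕ → V → V → Prop) : Prop where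
  zero : ∀ x y, L 0 x y ↔ x = y
  split : ∀ m n x z, L (m + n) x z ↔ ∃ y, L m x y ∧ L n y z
  mono : ∀ m n x y, m ≤ n → L m x y → L n x y
  finite_out : ∀ n x, {y | L n x y}.Finite
  finite_in : ∀ n x, {y | L n y x}.Finite

/-- `y` is reachable from `x`. -/
def Reach {V : Type*} (L : ℕ → V → V → Prop) (x y : V) : Prop := ∃ n, L n x y

/-- The vertices `g 0, …, g n` form a geodesic. -/
def IsGeo {V : Type*} (L : ℕ → V → V → Prop) (n : ℕ) (g : ℕ → V) : Prop :=
  (∀ s < n, L 1 (g s) (g (s + 1))) ∧ ∀ m, L m (g 0) (g n) → n ≤ m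

/-- The vertices `g 0, …, g n` form a geodesic from `x` to `y` or from `y` to `x`. -/
def IsGeoSide {V : Type*} (L : ℕ → V → V → Prop) (x y : V) (n : ℕ) (g : ℕ → V) : Prop :=
  IsGeo L n g ∧ (g 0 = x ∧ g n = y ∨ g 0 = y ∧ g n = x)

/-- Geodesic triangles are `k`-thin. -/
def Thin {V : Type*} (L : ℕ → V → V → Prop) (k : ℕ) : Prop :=
  ∀ (n : ℕ) (p : ℕ → V), IsGeo L n p → ∀ (c : V) (n₁ : ℕ) (q : ℕ → V),
    IsGeoSide L (p 0) c n₁ q → ∀ (n₂ : ℕ) (r : ℕ → V), IsGeoSide L (p n) c n₂ r →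
      ∀ t ≤ n, (∃ s ≤ n₁, L k (q s) (p t)) ∨ ∃ s ≤ n₂, L k (p t) (r s)

theorem injective_of_forall_lt_ne {V : Type*} {Q : ℕ → V} (h : ∀ i j, i < j → Q i ≠ Q j) :
    Function.Injective Q := fun i j hij => by
  by_contra hne
  rcases Nat.lt_or_gt_of_ne hne with hlt | hlt
  · exact h i j hlt hij
  · exact h j i hlt hij.symm

section

variable {V : Type*} {L : ℕ → V → V → Prop}

theorem StepSystem.rev (hL : StepSystem L) : StepSystem (fun n x y => L n y x) where
  zero x y := by rw [hL.zero, eq_comm]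
  split m n x z := by
    rw [add_comm, hL.split]
    exact exists_congr fun y => and_comm
  mono m n x y h := hL.mono m n y x h
  finite_out := hL.finite_in
  finite_in := hL.finite_out

theorem StepSystem.refl (hL : StepSystem L) (n : ℕ) (x : V) : L n x x :=
  hL.mono 0 n x x n.zero_le ((hL.zero x x).2 rfl)

theorem StepSystem.trans (hL : StepSystem L) {m n : ℕ} {x y z : V} (h : L m x y) (h' : L n y z) :
    L (m + n) x z := (hL.split m n x z).2 ⟨y, h, h'⟩

theorem Reach.trans (hL : StepSystem L) {x y z : V} : Reach L x y → Reach L y z → Reach L x z :=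
  fun ⟨_, h⟩ ⟨_, h'⟩ => ⟨_, hL.trans h h'⟩

theorem StepSystem.walk (hL : StepSystem L) {g : ℕ → V} {n : ℕ}
    (hg : ∀ s < n, L 1 (g s) (g (s + 1))) {s t : ℕ} (hst : s ≤ t) (ht : t ≤ n) :
    L (t - s) (g s) (g t) := by
  induction t, hst using Nat.le_induction with
  | base => simpa using hL.refl 0 _
  | succ t hst ih =>
    have := hL.trans (ih (by omega)) (hg t (by omega))
    rwa [show t + 1 - s = t - s + 1 by omega]

theorem IsGeo.step (hL : StepSystem L) {n : ℕ} {g : ℕ → V} (hg : IsGeo L n g) {s t : ℕ}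
    (hst : s ≤ t) (ht : t ≤ n) : L (t - s) (g s) (g t) := hL.walk hg.1 hst ht

theorem IsGeo.le (hL : StepSystem L) {n : ℕ} {g : ℕ → V} (hg : IsGeo L n g) {s t m : ℕ}
    (hst : s ≤ t) (ht : t ≤ n) (h : L m (g s) (g t)) : t - s ≤ m := by
  have := hg.2 _ (hL.trans (hL.trans (hg.step hL s.zero_le (hst.trans ht)) h)
    (hg.step hL ht le_rfl))
  omega

theorem IsGeo.reach (hL : StepSystem L) {n : ℕ} {g : ℕ → V} (hg : IsGeo L n g) {s t : ℕ}
    (hst : s ≤ t) (ht : t ≤ n) : Reach L (g s) (g t) := ⟨_, hg.step hL hst ht⟩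

theorem IsGeo.shift (hL : StepSystem L) {n m : ℕ} {g : ℕ → V} (hg : IsGeo L n g) (hm : m ≤ n) :
    IsGeo L (n - m) fun s => g (m + s) := by
  refine ⟨fun s hs => hg.1 (m + s) (by omega), fun l hl => ?_⟩
  have := hg.le hL (s := m) (t := m + (n - m)) (by omega) (by omega) hl
  omega

theorem IsGeo.rev {n : ℕ} {g : ℕ → V} (hg : IsGeo L n g) :
    IsGeo (fun n x y => L n y x) n fun s => g (n - s) := by
  refine ⟨fun s hs => ?_, fun m hm => hg.2 m ?_⟩
  · have := hg.1 (n - (s + 1)) (by omega)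
    rwa [show n - (s + 1) + 1 = n - s by omega] at this
  · simpa using hm

theorem IsGeoSide.rev {x y : V} {n : ℕ} {g : ℕ → V} (hg : IsGeoSide L x y n g) :
    IsGeoSide (fun n x y => L n y x) x y n fun s => g (n - s) := by
  refine ⟨hg.1.rev, ?_⟩
  rcases hg.2 with h | h <;> simp [h]

theorem IsGeoSide.symm {x y : V} {n : ℕ} {g : ℕ → V} (hg : IsGeoSide L x y n g) :
    IsGeoSide L y x n g := ⟨hg.1, hg.2.symm⟩

/-- Reversing all edges exchanges the two ends of the first side and also out-balls with in-balls,
so the condition is self-dual. This is what transfers results on rays to anti-rays. -/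
theorem Thin.rev {k : ℕ} (h : Thin L k) : Thin (fun n x y => L n y x) k := by
  intro n p hp c n₁ q hq n₂ r hr t ht
  have := h n _ hp.rev c n₂ _ (by simpa using hr.rev) n₁ _ (by simpa using hq.rev) (n - t)
    (Nat.sub_le _ _)
  simp only [Nat.sub_sub_self ht] at this
  rcases this with ⟨s, -, h⟩ | ⟨s, -, h⟩
  · exact Or.inr ⟨n₂ - s, Nat.sub_le _ _, h⟩
  · exact Or.inl ⟨n₁ - s, Nat.sub_le _ _, h⟩

theorem StepSystem.exists_walk (hL : StepSystem L) {n : ℕ} {x y : V} (h : L n x y) :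
    ∃ g : ℕ → V, g 0 = x ∧ g n = y ∧ ∀ s < n, L 1 (g s) (g (s + 1)) := by
  induction n generalizing x with
  | zero => exact ⟨fun _ => x, rfl, (hL.zero x y).1 h, by simp⟩
  | succ n ih =>
    obtain ⟨z, hxz, hzy⟩ := (hL.split 1 n x y).1 (by rwa [add_comm])
    obtain ⟨g, h0, hn, hg⟩ := ih hzy
    refine ⟨fun s => Nat.casesOn s x g, rfl, hn, fun s hs => ?_⟩
    cases s with
    | zero => simpa [h0] using hxz
    | succ s => exact hg s (by omega)

theorem StepSystem.exists_geo_through (hL : StepSystem L) {t u : ℕ} {x v y : V} (h : L t x v)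
    (h' : L u v y) (hmin : ∀ m, L m x y → t + u ≤ m) :
    ∃ g : ℕ → V, IsGeo L (t + u) g ∧ g 0 = x ∧ g (t + u) = y ∧ g t = v := by
  obtain ⟨g, h0, ht, hg⟩ := hL.exists_walk h
  obtain ⟨g', h0', hu, hg'⟩ := hL.exists_walk h'
  let w : ℕ → V := fun s => if s ≤ t then g s else g' (s - t)
  have w0 : w 0 = x := by simp [w, h0]
  have wt : w t = v := by simp [w, ht]
  have wu : w (t + u) = y := by
    rcases u.eq_zero_or_pos with rfl | hu'
    · simp [w, ht, ← hu, h0']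
    · simp [w, hu, hu'.ne']
  refine ⟨w, ⟨fun s hs => ?_, fun m hm => hmin m (by rwa [w0, wu] at hm)⟩, w0, wu, wt⟩
  rcases lt_trichotomy s t with hst | rfl | hst
  · simpa [w, hst.le, Nat.succ_le_of_lt hst] using hg s hst
  · simpa [w, ht, ← h0'] using hg' 0 (by omega)
  · have := hg' (s - t) (by omega)
    simpa [w, hst.not_ge, show ¬ s + 1 ≤ t by omega, show s + 1 - t = s - t + 1 by omega] using this

theorem StepSystem.exists_geo (hL : StepSystem L) {x y : V} (h : Reach L x y) :
    ∃ (n : ℕ) (g : ℕ → V), IsGeo L n g ∧ g 0 = x ∧ g n = y := by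
  classical
  obtain ⟨g, hg, h0, hn, -⟩ := hL.exists_geo_through (Nat.find_spec h) (hL.refl 0 y)
    fun m hm => Nat.find_min' h hm
  exact ⟨_, g, hg, h0, hn⟩

/-- Geodesics that start in `o` and end farther and farther away converge along an ultrafilter to
an infinite geodesic. -/
theorem StepSystem.exists_limit (hL : StepSystem L) {o : V} {v : ℕ → V}
    (hv : ∀ r, ∀ᶠ n in atTop, ¬ L r o (v n)) {l : ℕ → ℕ} {G : ℕ → ℕ → V}
    (hG : ∀ n, IsGeo L (l n) (G n)) (h0 : ∀ n, G n 0 = o) (h1 : ∀ n, G n (l n) = v n) :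
    ∃ Q : ℕ → V, (∀ m, IsGeo L m Q) ∧ Q 0 = o ∧
      ∀ m, ∀ᶠ n in (hyperfilter ℕ : Filter ℕ), m ≤ l n ∧ ∀ s ≤ m, G n s = Q s := by
  have hlen : ∀ m, ∀ᶠ n in (hyperfilter ℕ : Filter ℕ), m ≤ l n := fun m => by
    filter_upwards [Nat.hyperfilter_le_atTop (hv m)] with n hn
    by_contra hlt
    refine hn (hL.mono (l n) m _ _ (by omega) ?_)
    have := (hG n).step hL (Nat.zero_le (l n)) le_rfl
    rwa [h0, h1, Nat.sub_zero] at this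
  -- For fixed `s` the vertices `G n s` lie in a finite ball, so the ultrafilter selects one of
  -- them. This replaces a diagonal sequence.
  have hex : ∀ s, ∃ y, ∀ᶠ n in (hyperfilter ℕ : Filter ℕ), G n s = y := fun s => by
    have : ∀ᶠ n in (hyperfilter ℕ : Filter ℕ), ∃ y ∈ {y | L s o y}, G n s = y := by
      filter_upwards [hlen s] with n hn
      refine ⟨G n s, ?_, rfl⟩
      have := (hG n).step hL (Nat.zero_le s) hn
      rwa [h0, Nat.sub_zero] at this
    obtain ⟨y, -, hy⟩ := (Ultrafilter.eventually_exists_mem_iff (hL.finite_out s o)).1 this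
    exact ⟨y, hy⟩
  choose Q hQ using hex
  have key : ∀ m, ∀ᶠ n in (hyperfilter ℕ : Filter ℕ), m ≤ l n ∧ ∀ s ≤ m, G n s = Q s := by
    intro m
    refine (hlen m).and ?_
    exact (eventually_all_finite (Set.finite_Iic m)).2 fun s _ => hQ s
  refine ⟨Q, fun m => ?_, ?_, key⟩
  · obtain ⟨n, hn, hs⟩ := (key m).exists
    refine ⟨fun s hsm => ?_, fun u hu => ?_⟩
    · rw [← hs s hsm.le, ← hs (s + 1) hsm]
      exact (hG n).1 s (by omega)
    · rw [← hs 0 m.zero_le, ← hs m le_rfl] at hu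
      simpa using (hG n).le hL m.zero_le hn hu
  · obtain ⟨n, hn⟩ := (hQ 0).exists
    rw [← hn, h0]

/-- A ray `x` in a thin digraph is joined in both directions to an infinite geodesic. -/
theorem StepSystem.exists_geodesic_ray (hL : StepSystem L) {k : ℕ} (hk : Thin L k) {x : ℕ → V}
    (hinj : Function.Injective x) (hx : ∀ i, L 1 (x i) (x (i + 1))) :
    ∃ Q : ℕ → V, (∀ m, IsGeo L m Q) ∧ (∀ i, ∃ j, Reach L (Q i) (x j)) ∧
      ∀ i, ∃ j, Reach L (x i) (Q j) := by
  have hreach : ∀ {i j}, i ≤ j → Reach L (x i) (x j) := fun hij =>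
    ⟨_, hL.walk (fun s _ => hx s) hij le_rfl⟩
  have hleave : ∀ {A : Set V}, A.Finite → ∀ᶠ n in atTop, x n ∉ A := fun hA => by
    have := hinj.tendsto_cofinite hA.compl_mem_cofinite
    rwa [Nat.cofinite_eq_atTop] at this
  choose l G hG h0 h1 using fun n => hL.exists_geo (hreach (Nat.zero_le n))
  obtain ⟨Q, hQ, -, hlim⟩ := hL.exists_limit (fun r => hleave (hL.finite_out r (x 0))) hG h0 h1
  refine ⟨Q, hQ, fun i => ?_, fun i => ?_⟩
  · obtain ⟨n, hn, hs⟩ := (hlim i).exists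
    refine ⟨n, ?_⟩
    rw [← hs i le_rfl, ← h1 n]
    exact (hG n).reach hL hn le_rfl
  · let A : Set V := ⋃ s ∈ Set.Iic (l i), {v | L k (G i s) v}
    have hA : A.Finite := (Set.finite_Iic _).biUnion fun s _ => hL.finite_out k _
    have hmem : ∀ v, v ∈ A ↔ ∃ s ≤ l i, L k (G i s) v := fun v => by simp [A]
    -- The index `j` is so late that `x j` is outside the finite set `A` and `G j` agrees with `Q`
    -- for `l i + k + 1 + k` steps. A geodesic from `x i` to `x j` therefore leaves `A`, and its
    -- first vertex outside `A` is examined.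
    obtain ⟨j, ⟨⟨-, hj⟩, hjA⟩, hij⟩ := (((hlim (l i + k + 1 + k)).and
      (Nat.hyperfilter_le_atTop (hleave hA))).and
      (Nat.hyperfilter_le_atTop (eventually_ge_atTop i))).exists
    obtain ⟨n, p, hp, p0, pn⟩ := hL.exists_geo (hreach hij)
    classical
    have hex : ∃ t, t ≤ n ∧ p t ∉ A := ⟨n, le_rfl, by rwa [pn]⟩
    obtain ⟨htn, htA⟩ := Nat.find_spec hex
    have hmin := fun {m} => Nat.find_min hex (m := m)
    generalize Nat.find hex = t at htn htA hmin
    have ht0 : t ≠ 0 := by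
      rintro rfl
      exact htA ((hmem _).2 ⟨l i, le_rfl, by rw [h1, p0]; exact hL.refl _ _⟩)
    obtain ⟨t, rfl⟩ := Nat.exists_eq_succ_of_ne_zero ht0
    have htA' : p t ∈ A := by
      by_contra h
      exact hmin (Nat.lt_succ_self t) ⟨by omega, h⟩
    obtain ⟨s', hs', hs'A⟩ := (hmem _).1 htA'
    -- This vertex is not close to `G i`, hence it has a walk of length at most `k` to some `G j s`.
    -- Going from `x 0` along `G i`, into `A`, one step out of it and on to `G j s` gives `s ≤ l i +
    -- k + 1 + k`, so that `G j s = Q s`.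
    rcases hk n p hp (x 0) (l i) (G i) ⟨hG i, Or.inr ⟨h0 i, by rw [h1, p0]⟩⟩ (l j) (G j)
      ⟨hG j, Or.inr ⟨h0 j, by rw [h1, pn]⟩⟩ (t + 1) htn with ⟨s, hs, h⟩ | ⟨s, hs, h⟩
    · exact absurd ((hmem _).2 ⟨s, hs, h⟩) htA
    · have hd := hL.trans (hL.trans (hL.trans ((hG i).step hL (Nat.zero_le s') hs') hs'A)
        (hp.1 t (by omega))) h
      rw [h0, ← h0 j] at hd
      have := (hG j).le hL (Nat.zero_le s) hs hd
      refine ⟨s, ?_⟩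
      rw [← hj s (by omega), ← p0]
      exact (hp.reach hL (Nat.zero_le _) htn).trans hL ⟨k, h⟩

end

end HypDigraph

namespace HypDigraph

open Filter

/-! ### Strong components -/

/-- There are directed walks of length at most `n` from `x` to `y` and from `y` to `x`. -/
def Mut {V : Type*} (L : ℕ → V → V → Prop) (n : ℕ) (x y : V) : Prop := L n x y ∧ L n y x

/-- `x` and `y` lie in the same strong component. -/
def Strong {V : Type*} (L : ℕ → V → V → Prop) (x y : V) : Prop := Reach L x y ∧ Reach L y x

/-- `x` lies in the strong component of `o`, at mutual distance larger than `r`. -/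
def Far {V : Type*} (L : ℕ → V → V → Prop) (o : V) (r : ℕ) (x : V) : Prop :=
  Strong L o x ∧ ¬ Mut L r o x

/-- `x` and `y` are adjacent vertices far away from `o`. -/
def FarStep {V : Type*} (L : ℕ → V → V → Prop) (o : V) (r : ℕ) (x y : V) : Prop :=
  (L 1 x y ∨ L 1 y x) ∧ Far L o r x ∧ Far L o r y

/-- There is a directed walk from `x` to `y` without vertices in `A`, or `x = y`. -/
def Conn {V : Type*} (L : ℕ → V → V → Prop) (A : Set V) : V → V → Prop :=
  Relation.ReflTransGen fun x y => L 1 x y ∧ x ∉ A ∧ y ∉ A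

theorem exists_forall_linear_lt_two_pow (a b : ℕ) : ∃ p, ∀ q ≥ p, a * q + b < 2 ^ q := by
  have h := tendsto_pow_const_div_const_pow_of_one_lt 1 (show (1 : ℝ) < 2 by norm_num)
  have h' : ∀ᶠ q : ℕ in atTop, (q : ℝ) ^ 1 / 2 ^ q < 1 / (a + b + 1) :=
    h.eventually_lt_const (by positivity)
  obtain ⟨p, hp⟩ := eventually_atTop.1 h'
  refine ⟨max p 1, fun q hq => ?_⟩
  have hq' := hp q (le_of_max_le_left hq)
  rw [pow_one, div_lt_div_iff₀ (by positivity) (by positivity), one_mul] at hq'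
  have h1 : 1 ≤ q := le_of_max_le_right hq
  have hq'' : q * (a + b + 1) < 2 ^ q := by exact_mod_cast hq'
  nlinarith

section

variable {V : Type*} {L : ℕ → V → V → Prop}

theorem Mut.symm {n : ℕ} {x y : V} (h : Mut L n x y) : Mut L n y x := ⟨h.2, h.1⟩

theorem Mut.mono (hL : StepSystem L) {m n : ℕ} {x y : V} (hmn : m ≤ n) (h : Mut L m x y) :
    Mut L n x y := ⟨hL.mono _ _ _ _ hmn h.1, hL.mono _ _ _ _ hmn h.2⟩

theorem Mut.trans (hL : StepSystem L) {m n : ℕ} {x y z : V} (h : Mut L m x y) (h' : Mut L n y z) :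
    Mut L (m + n) x z := ⟨hL.trans h.1 h'.1, by rw [add_comm]; exact hL.trans h'.2 h.2⟩

theorem Strong.reach (hL : StepSystem L) {o x y : V} (hx : Strong L o x) (hy : Strong L o y) :
    Reach L x y := hx.2.trans hL hy.1

theorem Strong.refl (hL : StepSystem L) (o : V) : Strong L o o := ⟨⟨0, hL.refl 0 o⟩, ⟨0, hL.refl 0 o⟩⟩

theorem Strong.exists_mut (hL : StepSystem L) {o x : V} (h : Strong L o x) : ∃ n, Mut L n o x := by
  obtain ⟨⟨m, hm⟩, n, hn⟩ := h
  exact ⟨max m n, hL.mono _ _ _ _ (le_max_left m n) hm, hL.mono _ _ _ _ (le_max_right m n) hn⟩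

theorem Strong.of_reach (hL : StepSystem L) {o x y z : V} (hx : Strong L o x) (hz : Strong L o z)
    (h : Reach L x y) (h' : Reach L y z) : Strong L o y :=
  ⟨hx.1.trans hL h, h'.trans hL hz.2⟩

theorem Far.mono (hL : StepSystem L) {o x : V} {r r' : ℕ} (h : r ≤ r') (hx : Far L o r' x) :
    Far L o r x := ⟨hx.1, fun h' => hx.2 (h'.mono hL h)⟩

theorem FarStep.mono (hL : StepSystem L) {o x y : V} {r r' : ℕ} (h : r ≤ r')
    (hx : FarStep L o r' x y) : FarStep L o r x y := ⟨hx.1, hx.2.1.mono hL h, hx.2.2.mono hL h⟩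

theorem FarStep.symm {o x y : V} {r : ℕ} (h : FarStep L o r x y) : FarStep L o r y x :=
  ⟨h.1.symm, h.2.2, h.2.1⟩

theorem FarStep.chain_symm {o x y : V} {r : ℕ} (h : Relation.ReflTransGen (FarStep L o r) x y) :
    Relation.ReflTransGen (FarStep L o r) y x := by
  have : Std.Symm (FarStep L o r) := ⟨fun _ _ => FarStep.symm⟩
  exact Std.Symm.symm _ _ h

theorem IsGeo.strong (hL : StepSystem L) {o : V} {n t : ℕ} {g : ℕ → V} (hg : IsGeo L n g)
    (h0 : Strong L o (g 0)) (hn : Strong L o (g n)) (ht : t ≤ n) : Strong L o (g t) :=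
  h0.of_reach hL hn (hg.reach hL t.zero_le ht) (hg.reach hL ht le_rfl)

theorem IsGeoSide.strong (hL : StepSystem L) {o a b : V} {n t : ℕ} {g : ℕ → V}
    (hg : IsGeoSide L a b n g) (ha : Strong L o a) (hb : Strong L o b) (ht : t ≤ n) :
    Strong L o (g t) := by
  rcases hg with ⟨hg, ⟨rfl, rfl⟩ | ⟨rfl, rfl⟩⟩
  · exact hg.strong hL ha hb ht
  · exact hg.strong hL hb ha ht

theorem StepSystem.exists_side (hL : StepSystem L) {o a b : V} (ha : Strong L o a)
    (hb : Strong L o b) : ∃ n g, IsGeoSide L a b n g := by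
  obtain ⟨n, g, hg, h0, hn⟩ := hL.exists_geo (ha.reach hL hb)
  exact ⟨n, g, hg, Or.inl ⟨h0, hn⟩⟩

/-- `F` bounds the lengths of the ways back. -/
def Reversible {V : Type*} (L : ℕ → V → V → Prop) (F : ℕ → ℕ) : Prop :=
  ∀ n x y, L n x y → Reach L y x → Mut L (F n) x y

variable {k : ℕ} {F : ℕ → ℕ}

/-- All vertices on the three sides lie in one strong component, so the directed bound `k` can be
reversed at the cost of `F`. After that the directions of the sides no longer matter. -/
theorem Thin.mut (hL : StepSystem L) (hk : Thin L k) (hF : Reversible L F) {o a b c : V}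
    (ha : Strong L o a) (hb : Strong L o b) (hc : Strong L o c) {n n₁ n₂ : ℕ} {p q r : ℕ → V}
    (hp : IsGeoSide L a b n p) (hq : IsGeoSide L a c n₁ q) (hr : IsGeoSide L b c n₂ r)
    {t : ℕ} (ht : t ≤ n) :
    (∃ s ≤ n₁, Mut L (F k) (p t) (q s)) ∨ ∃ s ≤ n₂, Mut L (F k) (p t) (r s) := by
  have hpt := hp.strong hL ha hb ht
  have hqs := fun s (hs : s ≤ n₁) => hq.strong hL ha hc hs
  have hrs := fun s (hs : s ≤ n₂) => hr.strong hL hb hc hs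
  obtain ⟨hp, ⟨rfl, rfl⟩ | ⟨rfl, rfl⟩⟩ := hp
  · rcases hk n p hp c n₁ q hq n₂ r hr t ht with ⟨s, hs, h⟩ | ⟨s, hs, h⟩
    · exact Or.inl ⟨s, hs, (hF _ _ _ h (hpt.reach hL (hqs s hs))).symm⟩
    · exact Or.inr ⟨s, hs, hF _ _ _ h ((hrs s hs).reach hL hpt)⟩
  · rcases hk n p hp c n₂ r hr n₁ q hq t ht with ⟨s, hs, h⟩ | ⟨s, hs, h⟩
    · exact Or.inr ⟨s, hs, (hF _ _ _ h (hpt.reach hL (hrs s hs))).symm⟩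
    · exact Or.inl ⟨s, hs, hF _ _ _ h ((hqs s hs).reach hL hpt)⟩

theorem IsGeoSide.length_le {a b : V} {n m : ℕ} {g : ℕ → V}
    (hg : IsGeoSide L a b n g) (h : Mut L m a b) : n ≤ m := by
  rcases hg with ⟨hg, ⟨rfl, rfl⟩ | ⟨rfl, rfl⟩⟩
  · exact hg.2 _ h.1
  · exact hg.2 _ h.2

/-- A vertex on a side of length at most `m` is close to the end vertex `a`. -/
theorem IsGeoSide.mut_left (hL : StepSystem L) (hF : Reversible L F) {o a b : V}
    (ha : Strong L o a) (hb : Strong L o b) {n m t : ℕ} {g : ℕ → V}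
    (hg : IsGeoSide L a b n g) (hn : n ≤ m) (ht : t ≤ n) : Mut L (F m) (g t) a := by
  have hgt := hg.strong hL ha hb ht
  rcases hg with ⟨hg, ⟨rfl, rfl⟩ | ⟨rfl, rfl⟩⟩
  · exact (hF _ _ _ (hL.mono _ m _ _ (by omega) (hg.step hL t.zero_le ht))
      (hgt.reach hL ha)).symm
  · exact hF _ _ _ (hL.mono _ m _ _ (by omega) (hg.step hL ht le_rfl)) (ha.reach hL hgt)

/-! ### Sides along a sequence with adjacent consecutive vertices -/

section Sequence

variable {o : V} {x : ℕ → V}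

/-- A side between two vertices of a walk of length `2 ^ m` is logarithmically close to it. -/
theorem dyadic_close (hL : StepSystem L) (hk : Thin L k) (hF : Reversible L F)
    (hxo : ∀ i, Strong L o (x i)) (hx : ∀ i, L 1 (x i) (x (i + 1)) ∨ L 1 (x (i + 1)) (x i))
    (m : ℕ) : ∀ i j, i ≤ j → j ≤ i + 2 ^ m → ∀ n g, IsGeoSide L (x i) (x j) n g → ∀ t ≤ n,
      ∃ l ≥ i, Mut L (F (F 1) + m * F k) (g t) (x l) := by
  induction m with
  | zero =>
    intro i j hij hj n g hg t ht
    refine ⟨i, le_rfl, ?_⟩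
    rw [Nat.zero_mul, add_zero]
    refine hg.mut_left hL hF (hxo i) (hxo j) (hg.length_le ?_) ht
    obtain rfl | rfl : j = i ∨ j = i + 1 := by omega
    · exact ⟨hL.refl _ _, hL.refl _ _⟩
    · rcases hx i with h | h
      · exact hF _ _ _ h ((hxo _).reach hL (hxo _))
      · exact (hF _ _ _ h ((hxo _).reach hL (hxo _))).symm
  | succ m ih =>
    intro i j hij hj n g hg t ht
    rw [pow_succ] at hj
    by_cases hj' : j ≤ i + 2 ^ m
    · obtain ⟨l, hl, h⟩ := ih i j hij hj' n g hg t ht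
      exact ⟨l, hl, h.mono hL (by nlinarith)⟩
    obtain ⟨n₁, q, hq⟩ := hL.exists_side (hxo i) (hxo (i + 2 ^ m))
    obtain ⟨n₂, r, hr⟩ := hL.exists_side (hxo j) (hxo (i + 2 ^ m))
    rcases hk.mut hL hF (hxo i) (hxo j) (hxo (i + 2 ^ m)) hg hq hr ht with
      ⟨s, hs, h⟩ | ⟨s, hs, h⟩
    · obtain ⟨l, hl, h'⟩ := ih i (i + 2 ^ m) (by omega) le_rfl n₁ q hq s hs
      exact ⟨l, hl, (h.trans hL h').mono hL (by nlinarith)⟩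
    · obtain ⟨l, hl, h'⟩ := ih (i + 2 ^ m) j (by omega) (by omega) n₂ r hr.symm s hs
      exact ⟨l, by omega, (h.trans hL h').mono hL (by nlinarith)⟩

/-- Cutting at the successive powers of two, a vertex of the side is traced to a dyadic block
beginning at `2 ^ q`. This takes `q - p` triangles, at most one more triangle for the side of the
block, and `q` halvings inside it. The error is thus linear in `q` although the index `l` is at
least `2 ^ q`. -/
theorem dyadic_close_tail (hL : StepSystem L) (hk : Thin L k) (hF : Reversible L F)
    (hxo : ∀ i, Strong L o (x i)) (hx : ∀ i, L 1 (x i) (x (i + 1)) ∨ L 1 (x (i + 1)) (x i))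
    (m : ℕ) : ∀ p j, 2 ^ p ≤ j → j ≤ 2 ^ (p + m) → ∀ n g, IsGeoSide L (x (2 ^ p)) (x j) n g →
      ∀ t ≤ n, ∃ q ≥ p, ∃ l ≥ 2 ^ q,
        Mut L (F (F 1) + (q + (q - p) + 1) * F k) (g t) (x l) := by
  have base : ∀ p j, 2 ^ p ≤ j → j ≤ 2 ^ (p + 1) → ∀ n g, IsGeoSide L (x (2 ^ p)) (x j) n g →
      ∀ t ≤ n, ∃ l ≥ 2 ^ p, Mut L (F (F 1) + p * F k) (g t) (x l) :=
    fun p j hp hj => dyadic_close hL hk hF hxo hx p _ j hp (by rw [pow_succ] at hj; omega)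
  induction m with
  | zero =>
    intro p j hp hj n g hg t ht
    obtain ⟨l, hl, h⟩ := base p j hp (hj.trans (Nat.pow_le_pow_right two_pos (by omega))) n g hg t ht
    exact ⟨p, le_rfl, l, hl, h.mono hL (by gcongr; omega)⟩
  | succ m ih =>
    intro p j hp hj n g hg t ht
    by_cases hj' : j ≤ 2 ^ (p + 1)
    · obtain ⟨l, hl, h⟩ := base p j hp hj' n g hg t ht
      exact ⟨p, le_rfl, l, hl, h.mono hL (by gcongr; omega)⟩
    obtain ⟨n₁, q, hq⟩ := hL.exists_side (hxo (2 ^ p)) (hxo (2 ^ (p + 1)))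
    obtain ⟨n₂, r, hr⟩ := hL.exists_side (hxo j) (hxo (2 ^ (p + 1)))
    rcases hk.mut hL hF (hxo _) (hxo j) (hxo _) hg hq hr ht with ⟨s, hs, h⟩ | ⟨s, hs, h⟩
    · obtain ⟨l, hl, h'⟩ := base p (2 ^ (p + 1)) (Nat.pow_le_pow_right two_pos (by omega)) le_rfl
        n₁ q hq s hs
      refine ⟨p, le_rfl, l, hl, (h.trans hL h').mono hL ?_⟩
      simp only [Nat.sub_self, add_zero]
      linarith
    · obtain ⟨u, hu, l, hl, h'⟩ := ih (p + 1) j (by omega)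
        (by rwa [show p + 1 + m = p + (m + 1) by omega]) n₂ r hr.symm s hs
      refine ⟨u, by omega, l, hl, (h.trans hL h').mono hL ?_⟩
      rw [show u + (u - p) + 1 = u + (u - (p + 1)) + 1 + 1 by omega]
      linarith

/-- The sides between the vertices of a sequence with linear growth leave every ball. -/
theorem eventually_side_far (hL : StepSystem L) (hk : Thin L k) (hF : Reversible L F)
    (hxo : ∀ i, Strong L o (x i)) (hx : ∀ i, L 1 (x i) (x (i + 1)) ∨ L 1 (x (i + 1)) (x i))
    {A B : ℕ} (hgrow : ∀ n l, Mut L n o (x l) → l ≤ A * n + B) (r : ℕ) :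
    ∃ p₀, ∀ p ≥ p₀, ∀ j ≥ 2 ^ p, ∀ n g, IsGeoSide L (x (2 ^ p)) (x j) n g → ∀ t ≤ n,
      Far L o r (g t) := by
  obtain ⟨p₀, hp₀⟩ := exists_forall_linear_lt_two_pow (A * (2 * F k))
    (A * (r + F (F 1) + F k) + B)
  refine ⟨p₀, fun p hp j hj n g hg t ht => ⟨hg.strong hL (hxo _) (hxo _) ht, fun h => ?_⟩⟩
  obtain ⟨q, hq, l, hl, h'⟩ := dyadic_close_tail hL hk hF hxo hx j p j hj
    (Nat.lt_two_pow_self.le.trans (Nat.pow_le_pow_right two_pos (by omega))) n g hg t ht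
  -- A vertex of the side within `r` of `o` would put `x l` within a distance linear in `q`, whereas
  -- `l ≥ 2 ^ q`.
  have h1 := hgrow _ l ((h.trans hL h').mono hL (n := r + (F (F 1) + (2 * q + 1) * F k))
    (by gcongr; omega))
  have h2 := hp₀ q (by omega)
  nlinarith

end Sequence

/-- If a geodesic from `o` to `v` has its first `m` edges in common with the infinite geodesic `Q`,
then the sides between `v` and later vertices of `Q` are far away from `o`. -/
theorem far_of_common_start (hL : StepSystem L) (hk : Thin L k) (hF : Reversible L F) {Q : ℕ → V}
    (hQ : ∀ m, IsGeo L m Q) (hQo : ∀ m, Strong L (Q 0) (Q m)) {l m : ℕ} {g : ℕ → V}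
    (hg : IsGeo L l g) (hgl : Strong L (Q 0) (g l)) (hml : m ≤ l) (hgQ : ∀ s ≤ m, g s = Q s)
    {r j n t : ℕ} (hr : r + F k < m) (hj : m ≤ j) {w : ℕ → V}
    (hw : IsGeoSide L (g l) (Q j) n w) (ht : t ≤ n) : Far L (Q 0) r (w t) := by
  refine ⟨hw.strong hL hgl (hQo j) ht, fun h => ?_⟩
  -- The third corner is the branching vertex `g m = Q m`. Both other sides are final pieces of
  -- geodesics from `Q 0`, so their vertices have distance at least `m > r + F k` from it.
  have hq : IsGeoSide L (g l) (Q m) (l - m) fun s => g (m + s) :=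
    ⟨hg.shift hL hml, Or.inr ⟨hgQ m le_rfl, by simp [hml]⟩⟩
  have hr' : IsGeoSide L (Q j) (Q m) (j - m) fun s => Q (m + s) :=
    ⟨(hQ j).shift hL hj, Or.inr ⟨rfl, by simp [hj]⟩⟩
  rcases hk.mut hL hF hgl (hQo j) (hQo m) hw hq hr' ht with ⟨s, hs, h'⟩ | ⟨s, hs, h'⟩
  · have h1 := (h.trans hL h').1
    rw [← hgQ 0 m.zero_le] at h1
    have := hg.le hL (Nat.zero_le (m + s)) (by omega) h1
    omega
  · have := (hQ j).le hL (Nat.zero_le (m + s)) (by omega) (h.trans hL h').1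
    omega

/-- A piece of a geodesic that starts in `o` is a chain of far steps. -/
theorem IsGeo.farChain (hL : StepSystem L) {n a b r : ℕ} {g : ℕ → V} (hg : IsGeo L n g)
    (hn : Strong L (g 0) (g n)) (hra : r < a) (hab : a ≤ b) (hbn : b ≤ n) :
    Relation.ReflTransGen (FarStep L (g 0) r) (g a) (g b) := by
  have hfar : ∀ s, a ≤ s → s ≤ n → Far L (g 0) r (g s) := fun s hs hsn =>
    ⟨hg.strong hL (Strong.refl hL _) hn hsn, fun h => by
      have := hg.le hL s.zero_le hsn h.1
      omega⟩
  induction b, hab using Nat.le_induction with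
  | base => exact .refl
  | succ b hab ih =>
    exact (ih (by omega)).tail ⟨Or.inl (hg.1 b (by omega)), hfar b hab (by omega),
      hfar (b + 1) (by omega) hbn⟩

/-- Translates "outside a finite set" into "far from `o`" for vertices of the strong component. -/
theorem StepSystem.exists_mut_bound (hL : StepSystem L) (o : V) {A : Set V} (hA : A.Finite) :
    ∃ r, ∀ x ∈ A, Strong L o x → Mut L r o x := by
  induction A, hA using Set.Finite.induction_on with
  | empty => exact ⟨0, by simp⟩
  | @insert a A _ _ ih =>
    obtain ⟨r, hr⟩ := ih
    by_cases ha : Strong L o a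
    · obtain ⟨n, hn⟩ := ha.exists_mut hL
      refine ⟨max r n, ?_⟩
      rintro x (rfl | hx) hxo
      · exact hn.mono hL (le_max_right _ _)
      · exact (hr x hx hxo).mono hL (le_max_left _ _)
    · refine ⟨r, ?_⟩
      rintro x (rfl | hx) hxo
      · exact absurd hxo ha
      · exact hr x hx hxo

theorem Conn.of_walk {A : Set V} {g : ℕ → V} {n : ℕ} (hg : ∀ s < n, L 1 (g s) (g (s + 1)))
    (hA : ∀ s ≤ n, g s ∉ A) : Conn L A (g 0) (g n) := by
  induction n with
  | zero => exact .refl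
  | succ n ih =>
    exact (ih (fun s hs => hg s (by omega)) fun s hs => hA s (by omega)).tail
      ⟨hg n (by omega), hA n (by omega), hA _ le_rfl⟩

/-- Chains of steps that are far enough away give directed walks outside a given finite set. -/
theorem exists_far_conn (hL : StepSystem L) (hF : Reversible L F) (o : V) {A : Set V}
    (hA : A.Finite) : ∃ r, (∀ x, Far L o r x → x ∉ A) ∧
      ∀ x y, Relation.ReflTransGen (FarStep L o r) x y → Conn L A x y := by
  obtain ⟨r, hr⟩ := hL.exists_mut_bound o hA
  have hfar : ∀ x, Far L o (r + F (F 1)) x → x ∉ A := fun x hx hxA =>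
    hx.2 ((hr x hxA hx.1).mono hL (by omega))
  refine ⟨r + F (F 1), hfar, fun x y h => ?_⟩
  have hstep : ∀ x y, FarStep L o (r + F (F 1)) x y → Conn L A x y := by
    rintro x y ⟨h | h, hx, hy⟩
    · exact .single ⟨h, hfar x hx, hfar y hy⟩
    -- The edge points the wrong way and is replaced by a walk of length at most `F 1`. Its vertices
    -- are within `F (F 1)` of `x`, so it cannot meet `A`.
    · obtain ⟨g, rfl, rfl, hg⟩ := hL.exists_walk (hF _ _ _ h (hx.1.reach hL hy.1)).2
      refine Conn.of_walk hg fun s hs hsA => hx.2 ?_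
      have h1 := hL.walk hg s.zero_le hs
      have h2 : Reach L (g s) (g 0) :=
        Reach.trans hL ⟨_, hL.walk hg hs le_rfl⟩ (hy.1.reach hL hx.1)
      have h3 := hF (F 1) _ _ (hL.mono _ (F 1) _ _ (by omega) h1) h2
      have h4 := hr _ hsA (hx.1.of_reach hL hx.1 ⟨_, h1⟩ h2)
      exact h4.trans hL h3.symm
  induction h with
  | refl => exact .refl
  | tail _ h ih => exact Relation.ReflTransGen.trans ih (hstep _ _ h)

end

end HypDigraph

namespace HypDigraph

open Filter Quiver

/-! ### The step system of a locally finite digraph -/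

section

variable {V : Type*} [Quiver V]

/-- There is a directed walk of length at most `n` from `x` to `y`. -/
def Within (n : ℕ) (x y : V) : Prop := ∃ p : Path x y, p.length ≤ n

theorem dist_le_natCast {n : ℕ} {x y : V} : dist x y ≤ n ↔ Within n x y := by
  constructor
  · intro h
    by_contra hn
    have : ((n + 1 : ℕ) : ℝ≥0∞) ≤ dist x y := le_iInf fun p => by
      have : n + 1 ≤ p.length := by
        by_contra hp
        exact hn ⟨p, by omega⟩
      exact_mod_cast this
    have : n + 1 ≤ n := by exact_mod_cast this.trans h
    omega
  · rintro ⟨p, hp⟩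
    exact (iInf_le _ p).trans (by exact_mod_cast hp)

theorem dist_eq_top_or (x y : V) : dist x y = ⊤ ∨ ∃ n : ℕ, dist x y = n := by
  by_cases h : Nonempty (Path x y)
  · obtain ⟨p, hp⟩ := ciInf_mem (fun p : Path x y => (p.length : ℕ))
    refine Or.inr ⟨p.length, le_antisymm (iInf_le _ p) (le_iInf fun q => ?_)⟩
    have := ciInf_le (OrderBot.bddBelow (Set.range fun p : Path x y => (p.length : ℕ))) q
    rw [← hp] at this
    exact_mod_cast this
  · rw [not_nonempty_iff] at h
    exact Or.inl (iInf_of_empty _)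

theorem dist_le_ofReal {r : ℝ} {x y : V} : dist x y ≤ ENNReal.ofReal r ↔ Within ⌊r⌋₊ x y := by
  rw [← dist_le_natCast]
  rcases dist_eq_top_or x y with h | ⟨n, h⟩
  · simp [h]
  · rw [h]
    constructor
    · intro hn
      rcases Nat.eq_zero_or_pos n with rfl | hn0
      · simp
      · have := (ENNReal.natCast_le_ofReal hn0.ne').1 hn
        exact_mod_cast Nat.le_floor this
    · intro hn
      have : n ≤ ⌊r⌋₊ := by exact_mod_cast hn
      rcases Nat.eq_zero_or_pos n with rfl | hn0
      · simp
      · exact (ENNReal.natCast_le_ofReal hn0.ne').2 ((Nat.le_floor_iff' hn0.ne').1 this)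

theorem reach_iff_nonempty {x y : V} : Reach Within x y ↔ Nonempty (Path x y) :=
  ⟨fun ⟨_, p, _⟩ => ⟨p⟩, fun ⟨p⟩ => ⟨_, p, le_rfl⟩⟩

theorem within_zero {x y : V} : Within 0 x y ↔ x = y := by
  constructor
  · rintro ⟨p, hp⟩
    exact Path.eq_of_length_zero p (by omega)
  · rintro rfl
    exact ⟨Path.nil, le_rfl⟩

theorem within_add {m n : ℕ} {x z : V} :
    Within (m + n) x z ↔ ∃ y, Within m x y ∧ Within n y z := by
  constructor
  · rintro ⟨p, hp⟩
    obtain ⟨y, p₁, p₂, rfl, h⟩ := p.exists_eq_comp_of_le_length (Nat.min_le_left p.length m)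
    refine ⟨y, ⟨p₁, by omega⟩, p₂, ?_⟩
    rw [Path.length_comp] at hp h
    omega
  · rintro ⟨y, ⟨p, hp⟩, q, hq⟩
    exact ⟨p.comp q, by rw [Path.length_comp]; omega⟩

theorem within_one {x y : V} (h : Within 1 x y) : x = y ∨ dist x y = 1 := by
  by_cases hxy : x = y
  · exact Or.inl hxy
  · refine Or.inr (le_antisymm (by exact_mod_cast dist_le_natCast.2 h) ?_)
    by_contra hlt
    rcases dist_eq_top_or x y with h' | ⟨n, h'⟩
    · simp [h'] at hlt
    · rw [h', not_le] at hlt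
      have : n < 1 := by exact_mod_cast hlt
      exact hxy (within_zero.1 (dist_le_natCast.1 (by rw [h']; exact_mod_cast (by omega))))

theorem stepSystem_within (hfin : LocallyFinite V) : StepSystem (Within (V := V)) where
  zero _ _ := within_zero
  split _ _ _ _ := within_add
  mono _ _ _ _ h := fun ⟨p, hp⟩ => ⟨p, hp.trans h⟩
  finite_out n := by
    induction n with
    | zero => exact fun x => (Set.finite_singleton x).subset fun y hy => (within_zero.1 hy).symm
    | succ n ih =>
      intro x
      refine ((ih x).biUnion fun y _ => (hfin y).1.insert y).subset fun z hz => ?_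
      obtain ⟨y, hxy, hyz⟩ := within_add.1 hz
      rcases within_one hyz with rfl | h
      · exact Set.mem_biUnion hxy (Or.inl rfl)
      · exact Set.mem_biUnion hxy (Or.inr h)
  finite_in n := by
    induction n with
    | zero => exact fun x => (Set.finite_singleton x).subset fun y hy => within_zero.1 hy
    | succ n ih =>
      intro x
      refine ((ih x).biUnion fun y _ => (hfin y).2.insert y).subset fun z hz => ?_
      obtain ⟨y, hxy, hyz⟩ := within_add.1 (by rwa [add_comm] : Within (1 + n) z x)
      rcases within_one hxy with rfl | h
      · exact Set.mem_biUnion hyz (Or.inl rfl)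
      · exact Set.mem_biUnion hyz (Or.inr h)

theorem nonempty_hom_of_within_one {x y : V} (h : Within 1 x y) (hxy : x ≠ y) :
    Nonempty (x ⟶ y) := by
  obtain ⟨p, hp⟩ := h
  cases p with
  | nil => exact absurd rfl hxy
  | cons q e =>
    rw [Path.length_cons] at hp
    obtain rfl := Path.eq_of_length_zero q (by omega)
    exact ⟨e⟩

theorem exists_path_of_walk {g : ℕ → V} {n : ℕ} (hg : ∀ s < n, Nonempty (g s ⟶ g (s + 1))) :
    ∃ p : Path (g 0) (g n), p.length = n ∧ ∀ v, v ∈ p.vertices ↔ ∃ s ≤ n, g s = v := by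
  induction n with
  | zero => exact ⟨Path.nil, rfl, fun v => by simp [eq_comm]⟩
  | succ n ih =>
    obtain ⟨p, hp, hv⟩ := ih fun s hs => hg s (by omega)
    obtain ⟨e⟩ := hg n (by omega)
    refine ⟨p.cons e, by simp [hp], fun v => ?_⟩
    rw [Path.mem_vertices_cons, hv]
    constructor
    · rintro (⟨s, hs, rfl⟩ | rfl)
      · exact ⟨s, by omega, rfl⟩
      · exact ⟨n + 1, le_rfl, rfl⟩
    · rintro ⟨s, hs, rfl⟩
      rcases Nat.lt_or_ge n s with h | h
      · exact Or.inr (by rw [show s = n + 1 by omega])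
      · exact Or.inl ⟨s, h, rfl⟩

theorem isGeodesic_iff {x y : V} {p : Path x y} :
    IsGeodesic p ↔ ∀ m, Within m x y → p.length ≤ m := by
  constructor
  · intro h m hm
    have := dist_le_natCast.2 hm
    rw [← h] at this
    exact_mod_cast this
  · intro h
    refine le_antisymm (le_iInf fun q => ?_) (iInf_le _ p)
    exact_mod_cast h q.length ⟨q, le_rfl⟩

theorem IsGeo.ne (hL : StepSystem (Within (V := V))) {n : ℕ} {g : ℕ → V} (hg : IsGeo Within n g)
    {s t : ℕ} (hst : s < t) (ht : t ≤ n) : g s ≠ g t := fun h => by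
  have := hg.le hL hst.le ht ((hL.zero _ _).2 h)
  omega

theorem IsGeo.hom (hL : StepSystem (Within (V := V))) {n : ℕ} {g : ℕ → V}
    (hg : IsGeo Within n g) {s : ℕ} (hs : s < n) : Nonempty (g s ⟶ g (s + 1)) :=
  nonempty_hom_of_within_one (hg.1 s hs) (hg.ne hL s.lt_succ_self hs)

theorem IsGeo.exists_path (hL : StepSystem (Within (V := V))) {n : ℕ} {g : ℕ → V}
    (hg : IsGeo Within n g) : ∃ p : Path (g 0) (g n), IsGeodesic p ∧
      ∀ v, v ∈ p.vertices ↔ ∃ s ≤ n, g s = v := by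
  obtain ⟨p, hp, hv⟩ := exists_path_of_walk (g := g) (n := n) fun s hs => hg.hom hL hs
  exact ⟨p, isGeodesic_iff.2 (by rw [hp]; exact hg.2), hv⟩

theorem IsGeoSide.isSide (hL : StepSystem (Within (V := V))) {x y : V} {n : ℕ} {g : ℕ → V}
    (hg : IsGeoSide Within x y n g) : IsSide x y {v | ∃ s ≤ n, g s = v} := by
  obtain ⟨hg, ⟨rfl, rfl⟩ | ⟨rfl, rfl⟩⟩ := hg
  all_goals obtain ⟨p, hp, hv⟩ := hg.exists_path hL
  · exact Or.inl ⟨p, hp, by ext v; exact (hv v).symm⟩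
  · exact Or.inr ⟨p, hp, by ext v; exact (hv v).symm⟩

theorem IsHyperbolic.thin (hL : StepSystem (Within (V := V))) {δ : ℝ} (h : IsHyperbolic V δ) :
    Thin (Within (V := V)) ⌊δ⌋₊ := by
  intro n p hp c n₁ q hq n₂ r hr t ht
  obtain ⟨P, hP, hv⟩ := hp.exists_path hL
  rcases h _ _ c P hP _ _ (hq.isSide hL) (hr.isSide hL) (p t) ((hv _).2 ⟨t, ht, rfl⟩) with
    ⟨_, ⟨s, hs, rfl⟩, h'⟩ | ⟨_, ⟨s, hs, rfl⟩, h'⟩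
  · exact Or.inl ⟨s, hs, dist_le_ofReal.1 h'⟩
  · exact Or.inr ⟨s, hs, dist_le_ofReal.1 h'⟩

/-- The out-ball of radius `n` around `x` contains both `x` and `y`, so (B1) bounds the way back by
`f n`. The maximum with `n` keeps the bound for the way forward. -/
theorem SatisfiesB1.reversible (hL : StepSystem (Within (V := V))) {f : ℝ → ℝ}
    (h : SatisfiesB1 V f) : Reversible (Within (V := V)) fun n => max n ⌊f n⌋₊ := by
  intro n x y hxy hyx
  refine ⟨hL.mono _ _ _ _ (le_max_left _ _) hxy, hL.mono ⌊f n⌋₊ _ _ _ (le_max_right _ _) ?_⟩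
  have hb : ∀ z, Within n x z → z ∈ outBall (n : ℝ) x := fun z hz => by
    rw [outBall, Set.mem_ofPred_eq, dist_le_ofReal, Nat.floor_natCast]
    exact hz
  obtain ⟨m, hm⟩ := hyx
  have hne : dist y x ≠ ⊤ := ((dist_le_natCast.2 hm).trans_lt (ENNReal.natCast_lt_top m)).ne
  rcases h x n n.cast_nonneg y (hb y hxy) x (hb x (hL.refl n x)) with h' | h'
  · exact absurd h' hne
  · rw [← dist_le_ofReal]
    exact (ENNReal.le_ofReal_iff_toReal_le hne (ENNReal.toReal_nonneg.trans h')).2 h'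

/-- The position of a vertex on a geodesic. -/
theorem IsGeodesic.exists_geo (hL : StepSystem (Within (V := V))) {x y v : V} {p : Path x y}
    (hp : IsGeodesic p) (hv : v ∈ p.vertices) :
    ∃ n g, IsGeo Within n g ∧ g 0 = x ∧ g n = y ∧ ∃ t ≤ n, g t = v := by
  obtain ⟨p₁, p₂, rfl⟩ := p.exists_eq_comp_of_mem_vertices hv
  obtain ⟨g, hg, h0, h1, ht⟩ := hL.exists_geo_through ⟨p₁, le_rfl⟩ ⟨p₂, le_rfl⟩
    fun m hm => by simpa using isGeodesic_iff.1 hp m hm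
  exact ⟨_, g, hg, h0, h1, _, Nat.le_add_right _ _, ht⟩

theorem reach_of_mem_vertices {x y v : V} {p : Path x y} (hv : v ∈ p.vertices) :
    Reach Within x v ∧ Reach Within v y := by
  obtain ⟨p₁, p₂, rfl⟩ := p.exists_eq_comp_of_mem_vertices hv
  exact ⟨⟨_, p₁, le_rfl⟩, ⟨_, p₂, le_rfl⟩⟩

/-! ### Rays and ends -/

theorem Conn.exists_path {A : Set V} {x y : V} (hx : x ∉ A) (h : Conn Within A x y) :
    ∃ p : Path x y, ∀ v ∈ p.vertices, v ∉ A := by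
  induction h with
  | refl => exact ⟨Path.nil, by simpa using hx⟩
  | @tail b c _ hbc ih =>
    obtain ⟨p, hp⟩ := ih
    by_cases hne : b = c
    · subst hne
      exact ⟨p, hp⟩
    · obtain ⟨e⟩ := nonempty_hom_of_within_one hbc.1 hne
      refine ⟨p.cons e, fun v hv => ?_⟩
      rcases (Path.mem_vertices_cons p e).1 hv with hv | rfl
      · exact hp v hv
      · exact hbc.2.2

theorem Conn.of_path {A : Set V} {x y : V} (p : Path x y) (hp : ∀ v ∈ p.vertices, v ∉ A) :
    Conn Within A x y := by
  induction p with
  | nil => exact .refl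
  | @cons b c q e ih =>
    have hq : ∀ v ∈ q.vertices, v ∉ A := fun v hv => hp v ((Path.mem_vertices_cons q e).2 (Or.inl hv))
    exact (ih hq).tail ⟨⟨e.toPath, le_rfl⟩, hq b q.end_mem_vertices,
      hp c ((Path.mem_vertices_cons q e).2 (Or.inr rfl))⟩

theorem Ray.within_one (R : Ray V) (i : ℕ) :
    if R.anti then Within 1 (R.vert (i + 1)) (R.vert i) else
      Within 1 (R.vert i) (R.vert (i + 1)) := by
  have := R.edge i
  split_ifs at this ⊢
  all_goals exact this.elim fun e => ⟨e.toPath, le_rfl⟩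

theorem Ray.eventually_notMem (R : Ray V) {A : Set V} (hA : A.Finite) :
    ∀ᶠ i in atTop, R.vert i ∉ A := by
  have := R.injective.tendsto_cofinite hA.compl_mem_cofinite
  rwa [Nat.cofinite_eq_atTop] at this

/-- A finite set meets only finitely many of infinitely many disjoint paths; conversely, disjoint
paths are chosen greedily, each avoiding the vertices of those before. The clause `R₁.vert i ∉ A` is
needed because `Conn` is reflexive even on `A`. -/
theorem endLE_iff {R₁ R₂ : Ray V} : EndLE R₁ R₂ ↔
    ∀ A : Set V, A.Finite → ∃ i j, R₁.vert i ∉ A ∧ Conn Within A (R₁.vert i) (R₂.vert j) := by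
  constructor
  · rintro ⟨i, j, p, hp⟩ A hA
    by_contra! hcon
    have : ∀ n, ∃ v ∈ (p n).vertices, v ∈ A := fun n => by
      by_contra! hn
      exact hcon (i n) (j n) (hn _ (p n).start_mem_vertices) (Conn.of_path (p n) hn)
    choose v hv hvA using this
    have hinj : Function.Injective v := fun m n hmn => by
      by_contra hne
      exact hp m n hne (v m) (hv m) (hmn ▸ hv n)
    exact Set.infinite_of_injective_forall_mem hinj hvA hA
  · intro h
    let α := Σ i j : ℕ, Path (R₁.vert i) (R₂.vert j)
    let r : α → α → Prop := fun p q => ∀ v ∈ p.2.2.vertices, v ∉ q.2.2.vertices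
    have : Std.Symm r := ⟨fun p q hpq v hv hv' => hpq v hv' hv⟩
    obtain ⟨p, -, hp⟩ := exists_seq_of_forall_finset_exists' (fun _ : α => True) r fun s _ => by
      have hfin : (⋃ q ∈ s, {v | v ∈ q.2.2.vertices}).Finite :=
        s.finite_toSet.biUnion fun q _ => q.2.2.vertices.finite_toSet
      obtain ⟨i, j, hi, hij⟩ := h _ hfin
      obtain ⟨q, hq⟩ := hij.exists_path hi
      exact ⟨⟨i, j, q⟩, trivial, fun x hx v hv hv' => hq v hv' (Set.mem_biUnion hx hv)⟩
    exact ⟨fun n => (p n).1, fun n => (p n).2.1, fun n => (p n).2.2, fun m n hmn => hp hmn⟩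

theorem Conn.notMem {A : Set V} {x y : V} (hx : x ∉ A) (h : Conn Within A x y) : y ∉ A := by
  obtain ⟨p, hp⟩ := h.exists_path hx
  exact hp y p.end_mem_vertices

theorem EndLE.exists_conn {R₁ R₂ : Ray V} (h : EndLE R₁ R₂) {A : Set V} (hA : A.Finite) (N : ℕ) :
    ∃ i ≥ N, ∃ j ≥ N, R₁.vert i ∉ A ∧ Conn Within A (R₁.vert i) (R₂.vert j) := by
  -- Deleting the first `N` vertices of both rays as well forces late end vertices.
  let B := R₁.vert '' Set.Iio N ∪ R₂.vert '' Set.Iio N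
  have hB : B.Finite := ((Set.finite_Iio N).image _).union ((Set.finite_Iio N).image _)
  obtain ⟨i, j, hi, hij⟩ := endLE_iff.1 h (A ∪ B) (hA.union hB)
  have hj := hij.notMem hi
  refine ⟨i, ?_, j, ?_, fun h => hi (Or.inl h), ?_⟩
  · by_contra hlt
    exact hi (Or.inr (Or.inl ⟨i, by simpa using hlt, rfl⟩))
  · by_contra hlt
    exact hj (Or.inr (Or.inr ⟨j, by simpa using hlt, rfl⟩))
  · exact Relation.ReflTransGen.mono (fun a b hab =>
      ⟨hab.1, fun h => hab.2.1 (Or.inl h), fun h => hab.2.2 (Or.inl h)⟩) _ _ hij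

theorem Ray.conn (R : Ray V) {A : Set V} {N : ℕ} (hN : ∀ i ≥ N, R.vert i ∉ A) {i j : ℕ}
    (hi : N ≤ i) (hij : i ≤ j) :
    if R.anti then Conn Within A (R.vert j) (R.vert i) else
      Conn Within A (R.vert i) (R.vert j) := by
  induction j, hij using Nat.le_induction with
  | base => split_ifs <;> exact .refl
  | succ j hij ih =>
    have h := R.within_one j
    have h1 := hN j (by omega)
    have h2 := hN (j + 1) (by omega)
    split_ifs at ih h ⊢
    · exact Relation.ReflTransGen.head ⟨h, h2, h1⟩ ih
    · exact Relation.ReflTransGen.tail ih ⟨h, h1, h2⟩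

/-- The two connecting walks are joined along `R₂`, so the one that has to come later on `R₂`
depends on the direction of `R₂`. -/
theorem EndLE.trans {R₁ R₂ R₃ : Ray V} (h : EndLE R₁ R₂) (h' : EndLE R₂ R₃) : EndLE R₁ R₃ := by
  refine endLE_iff.2 fun A hA => ?_
  obtain ⟨N, hN⟩ := eventually_atTop.1 (R₂.eventually_notMem hA)
  by_cases hanti : R₂.anti
  · obtain ⟨i', hi', j', -, -, hc'⟩ := h'.exists_conn hA N
    obtain ⟨i, -, j, hj, hi, hc⟩ := h.exists_conn hA i'
    have := R₂.conn hN hi' hj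
    rw [if_pos hanti] at this
    exact ⟨i, j', hi, (hc.trans this).trans hc'⟩
  · obtain ⟨i, -, j, hj, hi, hc⟩ := h.exists_conn hA N
    obtain ⟨i', hi', j', -, -, hc'⟩ := h'.exists_conn hA j
    have := R₂.conn hN hj hi'
    rw [if_neg hanti] at this
    exact ⟨i, j', hi, (hc.trans this).trans hc'⟩

theorem EndEquiv.symm {R₁ R₂ : Ray V} (h : EndEquiv R₁ R₂) : EndEquiv R₂ R₁ := ⟨h.2, h.1⟩

theorem EndEquiv.trans {R₁ R₂ R₃ : Ray V} (h : EndEquiv R₁ R₂) (h' : EndEquiv R₂ R₃) :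
    EndEquiv R₁ R₃ := ⟨h.1.trans h'.1, h'.2.trans h.2⟩

theorem Ray.reach (R : Ray V) {i j : ℕ} (hij : i ≤ j) :
    if R.anti then Reach Within (R.vert j) (R.vert i) else
      Reach Within (R.vert i) (R.vert j) := by
  have := R.conn (A := ∅) (N := 0) (fun _ _ => Set.notMem_empty _) i.zero_le hij
  have hreach : ∀ {x y : V}, Conn Within ∅ x y → Reach Within x y := fun h => by
    obtain ⟨p, -⟩ := h.exists_path (Set.notMem_empty _)
    exact ⟨_, p, le_rfl⟩
  split_ifs at this ⊢ <;> exact hreach this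

/-- On an anti-ray, all vertices after a good one reach it. On a ray, every vertex reaches a later
good one. -/
theorem Ray.eventually_reach (hL : StepSystem (Within (V := V))) (R : Ray V) {y : V}
    (h : ∃ᶠ i in atTop, Reach Within (R.vert i) y) :
    ∀ᶠ i in atTop, Reach Within (R.vert i) y := by
  rw [frequently_atTop] at h
  by_cases hanti : R.anti
  · obtain ⟨i, -, hi⟩ := h 0
    filter_upwards [eventually_ge_atTop i] with j hj
    have := R.reach hj
    rw [if_pos hanti] at this
    exact this.trans hL hi
  · refine Eventually.of_forall fun j => ?_
    obtain ⟨i, hij, hi⟩ := h j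
    have := R.reach hij
    rw [if_neg hanti] at this
    exact this.trans hL hi

theorem Ray.eventually_reach' (hL : StepSystem (Within (V := V))) (R : Ray V) {y : V}
    (h : ∃ᶠ i in atTop, Reach Within y (R.vert i)) :
    ∀ᶠ i in atTop, Reach Within y (R.vert i) := by
  rw [frequently_atTop] at h
  by_cases hanti : R.anti
  · refine Eventually.of_forall fun j => ?_
    obtain ⟨i, hij, hi⟩ := h j
    have := R.reach hij
    rw [if_pos hanti] at this
    exact hi.trans hL this
  · obtain ⟨i, -, hi⟩ := h 0
    filter_upwards [eventually_ge_atTop i] with j hj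
    have := R.reach hj
    rw [if_neg hanti] at this
    exact hi.trans hL this

/-- Late vertices of `R₂` are reachable from late vertices of `R₁`. -/
def ReachLE (R₁ R₂ : Ray V) : Prop :=
  ∀ N : ℕ, ∃ i ≥ N, ∃ j ≥ N, Reach Within (R₁.vert i) (R₂.vert j)

theorem EndLE.reachLE {R₁ R₂ : Ray V} (h : EndLE R₁ R₂) : ReachLE R₁ R₂ := fun N => by
  obtain ⟨i, hi, j, hj, hn, hc⟩ := h.exists_conn Set.finite_empty N
  obtain ⟨p, -⟩ := hc.exists_path hn
  exact ⟨i, hi, j, hj, _, p, le_rfl⟩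

theorem ReachLE.eventually_reach (hL : StepSystem (Within (V := V))) {R₁ R₂ : Ray V}
    (h : ReachLE R₁ R₂) {y : V} (hy : ∀ᶠ i in atTop, Reach Within y (R₁.vert i)) :
    ∀ᶠ i in atTop, Reach Within y (R₂.vert i) := by
  refine R₂.eventually_reach' hL (frequently_atTop.2 fun N => ?_)
  obtain ⟨M, hM⟩ := eventually_atTop.1 hy
  obtain ⟨i, hi, j, hj, hij⟩ := h (max M N)
  exact ⟨j, le_of_max_le_right hj, (hM i (le_of_max_le_left hi)).trans hL hij⟩

theorem ReachLE.eventually_reach' (hL : StepSystem (Within (V := V))) {R₁ R₂ : Ray V}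
    (h : ReachLE R₁ R₂) {y : V} (hy : ∀ᶠ i in atTop, Reach Within (R₂.vert i) y) :
    ∀ᶠ i in atTop, Reach Within (R₁.vert i) y := by
  refine R₁.eventually_reach hL (frequently_atTop.2 fun N => ?_)
  obtain ⟨M, hM⟩ := eventually_atTop.1 hy
  obtain ⟨i, hi, j, hj, hij⟩ := h (max M N)
  exact ⟨i, le_of_max_le_right hi, hij.trans hL (hM j (le_of_max_le_left hj))⟩

theorem ReachLE.eventually_strong (hL : StepSystem (Within (V := V))) {R₁ R₂ : Ray V}
    (h : ReachLE R₁ R₂) (h' : ReachLE R₂ R₁) {o : V}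
    (ho : ∀ᶠ i in atTop, Strong Within o (R₁.vert i)) :
    ∀ᶠ i in atTop, Strong Within o (R₂.vert i) :=
  (h.eventually_reach hL (ho.mono fun _ h => h.1)).and
    (h'.eventually_reach' hL (ho.mono fun _ h => h.2))

/-- If no strong component contains a tail of `R₁`, then a finite set does not meet any directed
walk from late vertices of `R₁` to late vertices of `R₂`. -/
theorem ReachLE.exists_separated (hL : StepSystem (Within (V := V))) {R₁ R₂ : Ray V}
    (h : ReachLE R₂ R₁) (hno : ¬ ∃ o, ∀ᶠ i in atTop, Strong Within o (R₁.vert i))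
    {A : Set V} (hA : A.Finite) : ∃ N, ∀ i ≥ N, ∀ j ≥ N, ∀ y ∈ A,
      Reach Within (R₁.vert i) y → ¬ Reach Within y (R₂.vert j) := by
  have hy : ∀ y ∈ A, ∀ᶠ N in atTop, ∀ i ≥ N, ∀ j ≥ N,
      Reach Within (R₁.vert i) y → ¬ Reach Within y (R₂.vert j) := by
    intro y _
    by_cases h1 : ∃ᶠ i in atTop, Reach Within (R₁.vert i) y
    · have h1' := R₁.eventually_reach hL h1
      -- Otherwise `y` reaches a tail of `R₂`, hence a tail of `R₁`, and is reached from a tail of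
      -- `R₁`.
      have h2 : ¬ ∃ᶠ j in atTop, Reach Within y (R₂.vert j) := fun h2 =>
        hno ⟨y, (h.eventually_reach hL (R₂.eventually_reach' hL h2)).and h1'⟩
      obtain ⟨N, hN⟩ := eventually_atTop.1 (not_frequently.1 h2)
      filter_upwards [eventually_ge_atTop N] with M hM i _ j hj _
      exact hN j (hM.trans hj)
    · obtain ⟨N, hN⟩ := eventually_atTop.1 (not_frequently.1 h1)
      filter_upwards [eventually_ge_atTop N] with M hM i hi j _ h'
      exact absurd h' (hN i (hM.trans hi))
  obtain ⟨N, hN⟩ := ((eventually_all_finite hA).2 hy).exists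
  exact ⟨N, fun i hi j hj y hyA => hN y hyA i hi j hj⟩

/-- Without a strong component that contains a tail, any walk between sufficiently late vertices
avoids `A`, so mere reachability suffices. -/
theorem ReachLE.endLE (hL : StepSystem (Within (V := V))) {R₁ R₂ : Ray V} (h : ReachLE R₁ R₂)
    (h' : ReachLE R₂ R₁) (hno : ¬ ∃ o, ∀ᶠ i in atTop, Strong Within o (R₁.vert i)) :
    EndLE R₁ R₂ := by
  refine endLE_iff.2 fun A hA => ?_
  obtain ⟨N, hN⟩ := h'.exists_separated hL hno hA
  obtain ⟨i, hi, j, hj, hij⟩ := h N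
  obtain ⟨p⟩ := reach_iff_nonempty.1 hij
  have hp : ∀ v ∈ p.vertices, v ∉ A := fun v hv hvA =>
    hN i hi j hj v hvA (reach_of_mem_vertices hv).1 (reach_of_mem_vertices hv).2
  exact ⟨i, j, hp _ p.start_mem_vertices, Conn.of_path p hp⟩

theorem ReachLE.endEquiv (hL : StepSystem (Within (V := V))) {R₁ R₂ : Ray V} (h : ReachLE R₁ R₂)
    (h' : ReachLE R₂ R₁) (hno : ¬ ∃ o, ∀ᶠ i in atTop, Strong Within o (R₁.vert i)) :
    EndEquiv R₁ R₂ :=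
  ⟨h.endLE hL h' hno, h'.endLE hL h fun ⟨o, ho⟩ => hno ⟨o, h'.eventually_strong hL h ho⟩⟩

theorem mem_outBall {r : ℝ} {x y : V} : y ∈ outBall r x ↔ Within ⌊r⌋₊ x y := dist_le_ofReal

theorem mem_inBall {r : ℝ} {x y : V} : y ∈ inBall r x ↔ Within ⌊r⌋₊ y x := dist_le_ofReal

theorem Ray.mem_ball (R : Ray V) (i : ℕ) :
    ∃ r, Within r (R.vert 0) (R.vert i) ∨ Within r (R.vert i) (R.vert 0) := by
  have := R.reach i.zero_le
  split_ifs at this <;> obtain ⟨n, hn⟩ := this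
  · exact ⟨n, Or.inr hn⟩
  · exact ⟨n, Or.inl hn⟩

/-- A path of length at most `M` that starts late enough starts outside the in-ball of radius `M`
around `A`, and so misses `A`. -/
theorem BoundaryLE.endLE (hL : StepSystem (Within (V := V))) {R₁ R₂ : Ray V}
    (h : BoundaryLE R₁ R₂) : EndLE R₁ R₂ := by
  obtain ⟨M, hM, h⟩ := h
  refine endLE_iff.2 fun A hA => ?_
  have hB : (⋃ a ∈ A, {y | Within ⌊M⌋₊ y a}).Finite := hA.biUnion fun a _ => hL.finite_in _ a
  obtain ⟨N, hN⟩ := eventually_atTop.1 (R₁.eventually_notMem hB)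
  choose r hr using R₁.mem_ball
  -- The sum of the radii is a common radius for the first `N` vertices of `R₁`, which excludes them
  -- as starting vertices.
  obtain ⟨i, j, p, hp, hpv⟩ := h (∑ i ∈ Finset.range N, r i : ℕ) (R₁.vert 0) (Nat.cast_nonneg _)
  have hi : N ≤ i := by
    by_contra hlt
    have hle : r i ≤ ∑ i ∈ Finset.range N, r i :=
      Finset.single_le_sum (fun _ _ => Nat.zero_le _) (Finset.mem_range.2 (by omega))
    refine hpv _ p.start_mem_vertices ?_
    rw [Set.mem_union, mem_outBall, mem_inBall, Nat.floor_natCast]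
    exact (hr i).imp (hL.mono _ _ _ _ hle) (hL.mono _ _ _ _ hle)
  have hpA : ∀ v ∈ p.vertices, v ∉ A := fun v hv hvA => by
    obtain ⟨p₁, p₂, rfl⟩ := p.exists_eq_comp_of_mem_vertices hv
    refine hN i hi (Set.mem_biUnion hvA ⟨p₁, Nat.le_floor ?_⟩)
    rw [Path.length_comp] at hp
    push_cast at hp
    linarith [(Nat.cast_nonneg p₂.length : (0 : ℝ) ≤ _)]
  exact ⟨i, j, hpA _ p.start_mem_vertices, Conn.of_path p hpA⟩

theorem BoundaryLE.refl (hL : StepSystem (Within (V := V))) (R : Ray V) : BoundaryLE R R := by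
  refine ⟨0, le_rfl, fun r x _ => ?_⟩
  obtain ⟨i, hi⟩ := (R.eventually_notMem
    ((hL.finite_out ⌊r⌋₊ x).union (hL.finite_in ⌊r⌋₊ x))).exists
  refine ⟨i, i, Path.nil, by simp, fun v hv => ?_⟩
  rw [Path.vertices_nil, List.mem_singleton] at hv
  rw [hv, Set.mem_union, mem_outBall, mem_inBall]
  exact hi

end

end HypDigraph

/-! ### Sets open in both topologies, and semiconnected components -/

namespace Semimetric

section

variable {X : Type*} {d : X → X → ℝ≥0∞}

theorem isOpen_forward_iff (h0 : ∀ x, d x x = 0) (htri : ∀ x y z, d x y ≤ d x z + d z y)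
    {U : Set X} : (forwardTopology d).IsOpen U ↔ ∀ y ∈ U, ∃ e > 0, ∀ z, d y z < e → z ∈ U := by
  constructor
  · intro hU
    induction hU with
    | basic s hs =>
      obtain ⟨x, r, rfl⟩ := hs
      intro y (hy : d x y < r)
      refine ⟨r - d x y, tsub_pos_of_lt hy, fun z hz => ?_⟩
      refine (htri x z y).trans_lt ?_
      rw [add_comm]
      exact lt_tsub_iff_right.1 hz
    | univ => exact fun y _ => ⟨1, one_pos, fun _ _ => trivial⟩
    | inter s t _ _ hs ht =>
      intro y hy
      obtain ⟨e, he, h⟩ := hs y hy.1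
      obtain ⟨e', he', h'⟩ := ht y hy.2
      exact ⟨min e e', lt_min he he', fun z hz =>
        ⟨h z (hz.trans_le (min_le_left _ _)), h' z (hz.trans_le (min_le_right _ _))⟩⟩
    | sUnion S _ ih =>
      rintro y ⟨s, hs, hy⟩
      obtain ⟨e, he, h⟩ := ih s hs y hy
      exact ⟨e, he, fun z hz => ⟨s, hs, h z hz⟩⟩
  · intro h
    choose! e he hU using h
    -- The generating balls have finite radii while `e y` may be `∞`, hence the truncation at 1.
    have hUnion : U = ⋃₀ {B | ∃ y ∈ U, B = {z | d y z < (min (e y) 1).toNNReal}} := by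
      ext z
      have htop : ∀ y, ((min (e y) 1).toNNReal : ℝ≥0∞) = min (e y) 1 := fun y =>
        ENNReal.coe_toNNReal (ne_top_of_le_ne_top ENNReal.one_ne_top (min_le_right _ _))
      constructor
      · intro hz
        refine ⟨_, ⟨z, hz, rfl⟩, ?_⟩
        change d z z < _
        rw [htop, h0]
        exact lt_min (he z hz) one_pos
      · rintro ⟨_, ⟨y, hy, rfl⟩, hz : d y z < _⟩
        rw [htop] at hz
        exact hU y hy z (hz.trans_le (min_le_left _ _))
    rw [hUnion]
    refine TopologicalSpace.GenerateOpen.sUnion _ ?_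
    rintro _ ⟨y, -, rfl⟩
    exact TopologicalSpace.GenerateOpen.basic _ ⟨y, _, rfl⟩

theorem isOpen_backward_iff (h0 : ∀ x, d x x = 0) (htri : ∀ x y z, d x y ≤ d x z + d z y)
    {U : Set X} : (backwardTopology d).IsOpen U ↔ ∀ y ∈ U, ∃ e > 0, ∀ z, d z y < e → z ∈ U :=
  isOpen_forward_iff (d := fun x y => d y x) h0 fun x y z => by
    rw [add_comm]
    exact htri y x z

theorem isBiopen_iff (h0 : ∀ x, d x x = 0) (htri : ∀ x y z, d x y ≤ d x z + d z y)
    {U : Set X} : IsBiopen d U ↔ ∀ y ∈ U, ∃ e > 0, ∀ z, d y z < e ∨ d z y < e → z ∈ U := by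
  rw [IsBiopen, isOpen_forward_iff h0 htri, isOpen_backward_iff h0 htri]
  constructor
  · rintro ⟨h, h'⟩ y hy
    obtain ⟨e, he, h⟩ := h y hy
    obtain ⟨e', he', h'⟩ := h' y hy
    exact ⟨min e e', lt_min he he', fun z hz => hz.elim
      (fun hz => h z (hz.trans_le (min_le_left _ _)))
      fun hz => h' z (hz.trans_le (min_le_right _ _))⟩
  · intro h
    exact ⟨fun y hy => (h y hy).imp fun e he => ⟨he.1, fun z hz => he.2 z (Or.inl hz)⟩,
      fun y hy => (h y hy).imp fun e he => ⟨he.1, fun z hz => he.2 z (Or.inr hz)⟩⟩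

/-- The trace of `T` on `A` is open in both topologies of `A`. -/
def IsBiopenIn (d : X → X → ℝ≥0∞) (A T : Set X) : Prop :=
  ∀ y ∈ A, y ∈ T → ∃ e > 0, ∀ z ∈ A, d y z < e ∨ d z y < e → z ∈ T

theorem isSemiconnected_iff (h0 : ∀ x, d x x = 0) (htri : ∀ x y z, d x y ≤ d x z + d z y)
    {A : Set X} : IsSemiconnected d A ↔
      ∀ T, IsBiopenIn d A T → IsBiopenIn d A Tᶜ → A ⊆ T ∨ A ⊆ Tᶜ := by
  have hiff : ∀ T : Set X, IsBiopen (fun x y : A => d x y) (Subtype.val ⁻¹' T) ↔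
      IsBiopenIn d A T := fun T => by
    rw [isBiopen_iff (d := fun x y : A => d x y) (fun x => h0 x) fun x y z => htri x y z]
    exact ⟨fun h y hy hyT => (h ⟨y, hy⟩ hyT).imp fun e he => ⟨he.1, fun z hz => he.2 ⟨z, hz⟩⟩,
      fun h y hy => (h y y.2 hy).imp fun e he => ⟨he.1, fun z hz => he.2 z z.2 hz⟩⟩
  constructor
  · intro h T hT hT'
    by_contra hcon
    obtain ⟨h1, h2⟩ := not_or.1 hcon
    obtain ⟨x, hx, hxT⟩ := Set.not_subset.1 h1
    obtain ⟨y, hy, hyT⟩ := Set.not_subset.1 h2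
    refine h ⟨Subtype.val ⁻¹' T, Subtype.val ⁻¹' Tᶜ, ⟨⟨y, hy⟩, not_not.1 hyT⟩, ⟨⟨x, hx⟩, hxT⟩,
      ?_, ?_, (hiff T).2 hT, (hiff Tᶜ).2 hT'⟩
    · exact disjoint_compl_right.preimage _
    · rw [Set.preimage_compl, Set.union_compl_self]
  · rintro h ⟨U, W, ⟨u, hu⟩, ⟨w, hw⟩, hdisj, hunion, hU, hW⟩
    obtain rfl : W = Uᶜ := (isCompl_iff.2 ⟨hdisj, codisjoint_iff.2 hunion⟩).compl_eq.symm
    have hpre : Subtype.val ⁻¹' (Subtype.val '' U) = U :=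
      Set.preimage_image_eq U Subtype.val_injective
    have hpre' : Subtype.val ⁻¹' (Subtype.val '' U)ᶜ = Uᶜ := by rw [Set.preimage_compl, hpre]
    rcases h (Subtype.val '' U) ((hiff _).1 (by rwa [hpre])) ((hiff _).1 (by rwa [hpre'])) with
      h | h
    · obtain ⟨w', hw', hww'⟩ := h w.2
      exact hw (Subtype.val_injective hww' ▸ hw')
    · exact h u.2 ⟨u, hu, rfl⟩

/-- A nonempty semiconnected set is contained in exactly one semiconnected component. -/
theorem existsUnique_semiconnectedComponent (h0 : ∀ x, d x x = 0)
    (htri : ∀ x y z, d x y ≤ d x z + d z y) {A : Set X} (hA : IsSemiconnected d A)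
    (hne : A.Nonempty) : ∃! C, IsSemiconnectedComponent d C ∧ A ⊆ C := by
  let M := ⋃₀ {B | IsSemiconnected d B ∧ A ⊆ B}
  have hAM : A ⊆ M := Set.subset_sUnion_of_mem ⟨hA, subset_rfl⟩
  have hsub : ∀ B, IsSemiconnected d B → A ⊆ B → B ⊆ M := fun B hB hAB =>
    Set.subset_sUnion_of_mem ⟨hB, hAB⟩
  have hM : IsSemiconnected d M := by
    obtain ⟨a, ha⟩ := hne
    rw [isSemiconnected_iff h0 htri]
    have hres : ∀ {B T : Set X}, B ⊆ M → IsBiopenIn d M T → IsBiopenIn d B T :=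
      fun hB hT y hy hyT => (hT y (hB hy) hyT).imp fun e he => ⟨he.1, fun z hz => he.2 z (hB hz)⟩
    have main : ∀ T, IsBiopenIn d M T → IsBiopenIn d M Tᶜ → a ∈ T → M ⊆ T := by
      rintro T hT hT' haT x ⟨B, ⟨hB, hAB⟩, hx⟩
      have hBM := hsub B hB hAB
      rcases (isSemiconnected_iff h0 htri).1 hB T (hres hBM hT) (hres hBM hT') with h | h
      · exact h hx
      · exact absurd haT (h (hAB ha))
    intro T hT hT'
    by_cases haT : a ∈ T
    · exact Or.inl (main T hT hT' haT)
    · exact Or.inr (main Tᶜ hT' (by rwa [compl_compl]) haT)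
  refine ⟨M, ⟨⟨hM, fun B hB hMB => hsub B hB (hAM.trans hMB)⟩, hAM⟩, ?_⟩
  rintro C ⟨hC, hAC⟩
  exact (hsub C hC.1 hAC).antisymm (hC.2 hM (hsub C hC.1 hAC))

end

end Semimetric

namespace HypDigraph

open Filter Quiver

section

variable {V : Type*} [Quiver V]

/-! ### Estimates for the distance on the union of the digraph and its boundary -/

theorem expNeg_anti {ε : ℝ} (hε : 0 < ε) {t t' : ℝ≥0∞} (h : t ≤ t') :
    expNeg ε t' ≤ expNeg ε t := by
  unfold expNeg
  by_cases ht' : t' = ⊤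
  · simp [ht']
  · have ht : t ≠ ⊤ := ne_top_of_le_ne_top ht' h
    rw [if_neg ht', if_neg ht]
    refine ENNReal.ofReal_le_ofReal (Real.exp_le_exp.2 ?_)
    nlinarith [ENNReal.toReal_mono ht' h]

theorem exists_expNeg_lt {ε : ℝ} (hε : 0 < ε) {e : ℝ≥0∞} (he : 0 < e) :
    ∃ r : ℕ, expNeg ε r < e := by
  have h : Tendsto (fun r : ℕ => ENNReal.ofReal (Real.exp (-ε * r))) atTop (nhds 0) := by
    rw [← ENNReal.ofReal_zero]
    refine ENNReal.tendsto_ofReal (Real.tendsto_exp_atBot.comp ?_)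
    exact (tendsto_natCast_atTop_atTop).const_mul_atTop_of_neg (neg_lt_zero.2 hε)
  obtain ⟨r, hr⟩ := (h.eventually_lt_const he).exists
  exact ⟨r, by simpa [expNeg] using hr⟩

theorem visualDist_le_rho (ε : ℝ) (S : Finset V) (η μ : WithBoundary V) :
    visualDist ε S η μ ≤ rho ε S η μ := by
  let c : ℕ → WithBoundary V := fun i => if i = 0 then η else μ
  refine (iInf_le _ 1).trans ((iInf_le _ c).trans ((iInf_le _ (if_pos rfl)).trans
    ((iInf_le _ (if_neg one_ne_zero)).trans ?_)))
  simp [c]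

theorem natCast_le_minDist {r : ℕ} {s v : V} (h : ¬ Within r s v) (h' : ¬ Within r v s) :
    (r : ℝ≥0∞) ≤ minDist s v :=
  le_min (le_of_not_ge fun hle => h (dist_le_natCast.1 hle))
    (le_of_not_ge fun hle => h' (dist_le_natCast.1 hle))

theorem geodLiminf_ge {r : ℕ} {s : V} {a b : ℕ → V} {N : ℕ}
    (h : ∀ i ≥ N, ∀ j ≥ N, ∀ p : Path (a i) (b j), IsGeodesic p → ∀ v ∈ p.vertices,
      (r : ℝ≥0∞) ≤ minDist s v) : (r : ℝ≥0∞) ≤ geodLiminf s a b :=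
  le_iSup_of_le N <| le_iInf fun i => le_iInf fun hi => le_iInf fun j => le_iInf fun hj =>
    le_iInf fun p => le_iInf fun hp => le_iInf fun v => le_iInf fun hv => h i hi j hj p hp v hv

/-- Points are close if the geodesics between them avoid a suitable finite set. -/
theorem exists_finite_visualDist_lt (hL : StepSystem (Within (V := V))) {ε : ℝ} (hε : 0 < ε)
    (S : Finset V) {e : ℝ≥0∞} (he : 0 < e) : ∃ A : Set V, A.Finite ∧
      ∀ (η μ : WithBoundary V), ∀ a ∈ approach η, ∀ b ∈ approach μ, Linked a b →
        ∀ N : ℕ, (∀ i ≥ N, ∀ j ≥ N, ∀ p : Path (a i) (b j), IsGeodesic p →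
          ∀ v ∈ p.vertices, v ∉ A) → visualDist ε S η μ < e := by
  obtain ⟨r, hr⟩ := exists_expNeg_lt hε he
  refine ⟨⋃ s ∈ S, ({v | Within r s v} ∪ {v | Within r v s}),
    S.finite_toSet.biUnion fun s _ => (hL.finite_out r s).union (hL.finite_in r s),
    fun η μ a ha b hb hlink N hN => ?_⟩
  refine ((visualDist_le_rho ε S η μ).trans (iSup₂_le fun s hs => ?_)).trans_lt hr
  refine (iInf_le _ a).trans ((iInf_le _ ha).trans ((iInf_le _ b).trans ((iInf_le _ hb).trans
    ((iInf_le _ hlink).trans (expNeg_anti hε (geodLiminf_ge (N := N) ?_))))))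
  intro i hi j hj p hp v hv
  have hvA := hN i hi j hj p hp v hv
  exact natCast_le_minDist (fun h => hvA (Set.mem_biUnion hs (Or.inl h)))
    fun h => hvA (Set.mem_biUnion hs (Or.inr h))

/-- Geodesics exist in both directions inside the strong component, and `IsGeoSide` does not fix the
direction. One radius thus controls both distances. -/
theorem exists_far_visualDist_lt (hL : StepSystem (Within (V := V))) {ε : ℝ} (hε : 0 < ε)
    (S : Finset V) (o : V) {e : ℝ≥0∞} (he : 0 < e) : ∃ r : ℕ,
      ∀ (η μ : WithBoundary V), ∀ a ∈ approach η, ∀ b ∈ approach μ, ∀ N : ℕ,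
        (∀ i ≥ N, Strong Within o (a i)) → (∀ j ≥ N, Strong Within o (b j)) →
        (∀ i ≥ N, ∀ j ≥ N, ∀ n g, IsGeoSide Within (a i) (b j) n g →
          ∀ t ≤ n, Far Within o r (g t)) →
        visualDist ε S η μ < e ∧ visualDist ε S μ η < e := by
  obtain ⟨A, hA, h⟩ := exists_finite_visualDist_lt hL hε S he
  obtain ⟨r, hr⟩ := hL.exists_mut_bound o hA
  refine ⟨r, fun η μ a ha b hb N haN hbN hN => ⟨h η μ a ha b hb (fun M => ?_) N ?_,
    h μ η b hb a ha (fun M => ?_) N ?_⟩⟩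
  · exact ⟨max N M, le_max_right _ _, max N M, le_max_right _ _, reach_iff_nonempty.1
      ((haN _ (le_max_left _ _)).reach hL (hbN _ (le_max_left _ _)))⟩
  · intro i hi j hj p hp v hv hvA
    obtain ⟨n, g, hg, h0, hn, t, ht, rfl⟩ := hp.exists_geo hL hv
    have hfar := hN i hi j hj n g ⟨hg, Or.inl ⟨h0, hn⟩⟩ t ht
    exact hfar.2 (hr _ hvA hfar.1)
  · exact ⟨max N M, le_max_right _ _, max N M, le_max_right _ _, reach_iff_nonempty.1
      ((hbN _ (le_max_left _ _)).reach hL (haN _ (le_max_left _ _)))⟩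
  · intro i hi j hj p hp v hv hvA
    obtain ⟨n, g, hg, h0, hn, t, ht, rfl⟩ := hp.exists_geo hL hv
    have hfar := hN j hj i hi n g ⟨hg, Or.inr ⟨h0, hn⟩⟩ t ht
    exact hfar.2 (hr _ hvA hfar.1)

theorem exists_farStep_visualDist_lt (hL : StepSystem (Within (V := V))) {F : ℕ → ℕ}
    (hF : Reversible (Within (V := V)) F) {ε : ℝ} (hε : 0 < ε) (S : Finset V) (o : V)
    {e : ℝ≥0∞} (he : 0 < e) : ∃ r : ℕ, ∀ x y, FarStep Within o r x y →
      visualDist ε S (Sum.inl x) (Sum.inl y) < e ∧ visualDist ε S (Sum.inl y) (Sum.inl x) < e := by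
  obtain ⟨r, hr⟩ := exists_far_visualDist_lt hL hε S o he
  refine ⟨r + F (F 1), fun x y hxy => hr _ _ _ rfl _ rfl 0 (fun _ _ => hxy.2.1.1)
    (fun _ _ => hxy.2.2.1) fun _ _ _ _ n g hg t ht => ?_⟩
  obtain ⟨hadj, hx, hy⟩ := hxy
  refine ⟨hg.strong hL hx.1 hy.1 ht, fun h => hx.2 ?_⟩
  have hmut : Mut Within (F 1) x y := by
    rcases hadj with h | h
    · exact hF _ _ _ h (hy.1.reach hL hx.1)
    · exact (hF _ _ _ h (hx.1.reach hL hy.1)).symm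
  exact h.trans hL (hg.mut_left hL hF hx.1 hy.1 (hg.length_le hmut) ht)

/-! ### Boundary points -/

theorem dist_eq_natCast {n : ℕ} {x y : V} (h : Within n x y) (hmin : ∀ m, Within m x y → n ≤ m) :
    dist x y = n := by
  refine le_antisymm (dist_le_natCast.2 h) ?_
  rcases dist_eq_top_or x y with h' | ⟨m, h'⟩
  · simp [h']
  · rw [h']
    exact_mod_cast hmin m (dist_le_natCast.1 h'.le)

theorem exists_ray_of_geodesic (hL : StepSystem (Within (V := V))) {Q : ℕ → V}
    (hQ : ∀ m, IsGeo Within m Q) : ∃ R : Ray V, R.vert = Q ∧ R.IsQuasiGeodesic := by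
  have hne : ∀ i j, i < j → Q i ≠ Q j := fun i j hij => (hQ j).ne hL hij le_rfl
  refine ⟨⟨false, Q, injective_of_forall_lt_ne hne, fun i => ?_⟩, rfl, 1, 0, le_rfl, le_rfl,
    fun i j hij => ?_⟩
  · simpa using (hQ (i + 1)).hom hL i.lt_succ_self
  · have := dist_eq_natCast ((hQ j).step hL hij le_rfl) fun m => (hQ j).le hL hij le_rfl
    dsimp only
    simp only [Bool.false_eq_true, if_false, this, ENNReal.toReal_natCast, one_mul, add_zero,
      Nat.cast_sub hij, le_refl]

theorem exists_antiray_of_geodesic (hL : StepSystem (Within (V := V))) {Q : ℕ → V}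
    (hQ : ∀ m, IsGeo (fun n (x y : V) => Within n y x) m Q) :
    ∃ R : Ray V, R.vert = Q ∧ R.IsQuasiGeodesic := by
  have hne : ∀ i j, i < j → Q i ≠ Q j := fun i j hij h => by
    have := (hQ j).le hL.rev hij.le le_rfl ((hL.zero _ _).2 h.symm)
    omega
  refine ⟨⟨true, Q, injective_of_forall_lt_ne hne, fun i => ?_⟩, rfl, 1, 0, le_rfl, le_rfl,
    fun i j hij => ?_⟩
  · simpa using nonempty_hom_of_within_one ((hQ (i + 1)).1 i i.lt_succ_self)
      (hne i (i + 1) i.lt_succ_self).symm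
  · have := dist_eq_natCast ((hQ j).step hL.rev hij le_rfl) fun m => (hQ j).le hL.rev hij le_rfl
    dsimp only
    simp only [if_true, this, ENNReal.toReal_natCast, one_mul, add_zero, Nat.cast_sub hij, le_refl]

/-- The boundary point of a quasi-geodesic ray or anti-ray. -/
def Ray.toBoundary (R : Ray V) (hR : R.IsQuasiGeodesic) : Boundary V :=
  ⟨{R' | R'.IsQuasiGeodesic ∧ BoundaryEquiv R R'}, R, hR, rfl⟩

theorem Ray.mem_toBoundary (hL : StepSystem (Within (V := V))) {R : Ray V}
    (hR : R.IsQuasiGeodesic) : R ∈ (R.toBoundary hR).1 :=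
  ⟨hR, BoundaryLE.refl hL R, BoundaryLE.refl hL R⟩

theorem Ray.toBoundary_mem_pointsIn (hL : StepSystem (Within (V := V))) {R₀ R : Ray V}
    (hR : R.IsQuasiGeodesic) (h : EndEquiv R₀ R) :
    R.toBoundary hR ∈ pointsIn {R' | EndEquiv R₀ R'} :=
  fun _ hR' => h.trans ⟨hR'.2.1.endLE hL, hR'.2.2.endLE hL⟩

theorem exists_ray_of_mem_pointsIn (hL : StepSystem (Within (V := V))) {R₀ : Ray V}
    {η : Boundary V} (hη : η ∈ pointsIn {R' | EndEquiv R₀ R'}) :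
    ∃ R ∈ η.1, R.IsQuasiGeodesic ∧ EndEquiv R₀ R := by
  obtain ⟨R, hR, hRη⟩ := η.2
  have hmem : R ∈ η.1 := by
    rw [hRη]
    exact ⟨hR, BoundaryLE.refl hL R, BoundaryLE.refl hL R⟩
  exact ⟨R, hmem, hR, hη hmem⟩

/-! ### Ends without a tail in a strong component -/

theorem pointsIn_subsingleton_of_no_strong (hL : StepSystem (Within (V := V))) {ε : ℝ}
    (hε : 0 < ε) (S : Finset V) (hzero : ∀ x y, visualDist ε S x y = 0 → x = y) {R₀ : Ray V}
    (hno : ¬ ∃ o, ∀ᶠ i in atTop, Strong Within o (R₀.vert i)) :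
    (pointsIn {R' | EndEquiv R₀ R'}).Subsingleton := by
  intro η hη μ hμ
  obtain ⟨R₁, hR₁η, -, hR₁⟩ := exists_ray_of_mem_pointsIn hL hη
  obtain ⟨R₂, hR₂μ, -, hR₂⟩ := exists_ray_of_mem_pointsIn hL hμ
  have h12 := hR₁.symm.trans hR₂
  have hno' : ¬ ∃ o, ∀ᶠ i in atTop, Strong Within o (R₁.vert i) := fun ⟨o, ho⟩ =>
    hno ⟨o, hR₁.2.reachLE.eventually_strong hL hR₁.1.reachLE ho⟩
  refine Sum.inr_injective (hzero _ _ (le_antisymm (le_of_forall_gt fun e he => ?_) zero_le))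
  obtain ⟨A, hA, h⟩ := exists_finite_visualDist_lt hL hε S he
  obtain ⟨N, hN⟩ := h12.2.reachLE.exists_separated hL hno' hA
  refine h (Sum.inr η) (Sum.inr μ) R₁.vert ⟨R₁, hR₁η, rfl⟩ R₂.vert ⟨R₂, hR₂μ, rfl⟩
    (fun M => ?_) N fun i hi j hj p _ v hv hvA => ?_
  · obtain ⟨i, hi, j, hj, hij⟩ := h12.1.reachLE M
    exact ⟨i, hi, j, hj, reach_iff_nonempty.1 hij⟩
  · exact hN i hi j hj v hvA (reach_of_mem_vertices hv).1 (reach_of_mem_vertices hv).2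

/-- The geodesic ray from `exists_geodesic_ray` is only known to be mutually reachable with `R₀`,
which here already gives equivalence. Anti-rays are treated in the reversed digraph. -/
theorem exists_equiv_quasiGeodesic_of_no_strong (hL : StepSystem (Within (V := V))) {k : ℕ}
    (hk : Thin (Within (V := V)) k) {R₀ : Ray V}
    (hno : ¬ ∃ o, ∀ᶠ i in atTop, Strong Within o (R₀.vert i)) :
    ∃ R : Ray V, R.IsQuasiGeodesic ∧ EndEquiv R₀ R := by
  by_cases hanti : R₀.anti
  · have hR₀ := fun {i j} (hij : i ≤ j) => R₀.reach hij
    simp only [if_pos hanti] at hR₀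
    obtain ⟨Q, hQ, h1, h2⟩ := hL.rev.exists_geodesic_ray hk.rev R₀.injective fun i => by
      simpa [hanti] using R₀.within_one i
    obtain ⟨R, rfl, hR⟩ := exists_antiray_of_geodesic hL hQ
    refine ⟨R, hR, ReachLE.endEquiv hL (fun N => ?_) (fun N => ?_) hno⟩
    · obtain ⟨j, hj⟩ := h1 N
      exact ⟨max j N, le_max_right _ _, N, le_rfl, (hR₀ (le_max_left j N)).trans hL hj⟩
    · obtain ⟨j, hj⟩ := h2 N
      obtain ⟨n, hn⟩ := (hQ (max j N)).reach hL.rev (le_max_left j N) le_rfl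
      exact ⟨max j N, le_max_right _ _, N, le_rfl, Reach.trans hL ⟨n, hn⟩ hj⟩
  · have hR₀ := fun {i j} (hij : i ≤ j) => R₀.reach hij
    simp only [if_neg hanti] at hR₀
    obtain ⟨Q, hQ, h1, h2⟩ := hL.exists_geodesic_ray hk R₀.injective fun i => by
      simpa [hanti] using R₀.within_one i
    obtain ⟨R, rfl, hR⟩ := exists_ray_of_geodesic hL hQ
    refine ⟨R, hR, ReachLE.endEquiv hL (fun N => ?_) (fun N => ?_) hno⟩
    · obtain ⟨j, hj⟩ := h2 N
      exact ⟨N, le_rfl, max j N, le_max_right _ _,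
        hj.trans hL ((hQ (max j N)).reach hL (le_max_left j N) le_rfl)⟩
    · obtain ⟨j, hj⟩ := h1 N
      exact ⟨N, le_rfl, max j N, le_max_right _ _, hj.trans hL (hR₀ (le_max_left j N))⟩

end

end HypDigraph

namespace HypDigraph

open Filter Quiver

section

variable {V : Type*} [Quiver V]

/-! ### Ends with a tail in a strong component -/

theorem Ray.adjacent (R : Ray V) (i : ℕ) :
    Within 1 (R.vert i) (R.vert (i + 1)) ∨ Within 1 (R.vert (i + 1)) (R.vert i) := by
  have := R.within_one i
  split_ifs at this
  exacts [Or.inr this, Or.inl this]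

theorem Ray.eventually_far (hL : StepSystem (Within (V := V))) (R : Ray V) {o : V}
    (ho : ∀ᶠ i in atTop, Strong Within o (R.vert i)) (r : ℕ) :
    ∀ᶠ i in atTop, Far Within o r (R.vert i) := by
  filter_upwards [ho, R.eventually_notMem (hL.finite_out r o)] with i h h'
  exact ⟨h, fun hm => h' hm.1⟩

theorem Ray.farChain (R : Ray V) {o : V} {r N : ℕ} (h : ∀ i ≥ N, Far Within o r (R.vert i))
    {i j : ℕ} (hi : N ≤ i) (hij : i ≤ j) :
    Relation.ReflTransGen (FarStep Within o r) (R.vert i) (R.vert j) := by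
  induction j, hij using Nat.le_induction with
  | base => exact .refl
  | succ j hij ih => exact ih.tail ⟨R.adjacent j, h j (by omega), h (j + 1) (by omega)⟩

/-- A walk between two vertices of a strong component stays in it. For the induction from the head,
the first vertex is only assumed to be reachable from `o`. -/
theorem Conn.farChain (hL : StepSystem (Within (V := V))) {o : V} {r : ℕ} {x y : V}
    (h : Conn Within {v | Mut Within r o v} x y) (hx : Reach Within o x)
    (hy : Strong Within o y) : Relation.ReflTransGen (FarStep Within o r) x y := by
  induction h using Relation.ReflTransGen.head_induction_on with
  | refl => exact .refl
  | @head a c hac hcy ih =>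
    have hc : Reach Within o c := hx.trans hL ⟨1, hac.1⟩
    obtain ⟨p, -⟩ := Conn.exists_path hac.2.2 hcy
    have hc' : Strong Within o c := ⟨hc, Reach.trans hL ⟨_, p, le_rfl⟩ hy.2⟩
    exact .head ⟨Or.inl hac.1, ⟨⟨hx, Reach.trans hL ⟨1, hac.1⟩ hc'.2⟩, hac.2.1⟩, hc', hac.2.2⟩
      (ih hc)

/-- Mutual distance bounds both directed distances, so the quasi-geodesic inequality applies to rays
and anti-rays alike. -/
theorem Ray.IsQuasiGeodesic.growth {R : Ray V} (hR : R.IsQuasiGeodesic) {o : V} {i₀ : ℕ}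
    (hL : StepSystem (Within (V := V))) (ho : Strong Within o (R.vert i₀)) :
    ∃ A B : ℕ, ∀ n l, Mut Within n o (R.vert (i₀ + l)) → l ≤ A * n + B := by
  obtain ⟨γ, c, hγ, hc, h⟩ := hR
  obtain ⟨n₀, hn₀⟩ := ho.exists_mut hL
  refine ⟨⌈γ⌉₊, ⌈γ * n₀ + c⌉₊, fun n l hl => ?_⟩
  have hm := hn₀.symm.trans hL hl
  have hd := h i₀ (i₀ + l) (Nat.le_add_right _ _)
  have hle : ∀ {x y : V}, Within (n₀ + n) x y → (dist x y).toReal ≤ n₀ + n := fun hxy => by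
    have := ENNReal.toReal_mono (ENNReal.natCast_ne_top _) (dist_le_natCast.2 hxy)
    rw [ENNReal.toReal_natCast] at this
    exact_mod_cast this
  have hd' : (l : ℝ) ≤ γ * (n₀ + n) + c := by
    push_cast at hd
    refine le_trans (by linarith) (hd.trans ?_)
    gcongr
    split_ifs
    exacts [hle hm.2, hle hm.1]
  have h1 := Nat.le_ceil γ
  have h2 := Nat.le_ceil (γ * n₀ + c)
  have h3 : (l : ℝ) ≤ (⌈γ⌉₊ * n + ⌈γ * n₀ + c⌉₊ : ℕ) := by
    push_cast
    nlinarith [(Nat.cast_nonneg n : (0 : ℝ) ≤ n)]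
  exact_mod_cast h3

variable {k : ℕ} {F : ℕ → ℕ} {o : V}

/-- Some of the late vertices of a quasi-geodesic ray are close to its boundary point. -/
theorem exists_vert_close (hL : StepSystem (Within (V := V))) (hk : Thin (Within (V := V)) k)
    (hF : Reversible (Within (V := V)) F) {ε : ℝ} (hε : 0 < ε) (S : Finset V) {R : Ray V}
    (hR : R.IsQuasiGeodesic) (ho : ∀ᶠ i in atTop, Strong Within o (R.vert i)) {η : Boundary V}
    (hη : R ∈ η.1) {e : ℝ≥0∞} (he : 0 < e) (N : ℕ) :
    ∃ i ≥ N, visualDist ε S (Sum.inl (R.vert i)) (Sum.inr η) < e ∧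
      visualDist ε S (Sum.inr η) (Sum.inl (R.vert i)) < e := by
  obtain ⟨i₀, hi₀⟩ := eventually_atTop.1 ho
  obtain ⟨r, hr⟩ := exists_far_visualDist_lt hL hε S o he
  obtain ⟨A, B, hAB⟩ := hR.growth hL (hi₀ i₀ le_rfl)
  obtain ⟨p, hp⟩ := eventually_side_far hL hk hF (x := fun i => R.vert (i₀ + i))
    (fun i => hi₀ _ (Nat.le_add_right _ _)) (fun i => R.adjacent (i₀ + i)) hAB r
  have hlt : max p N < 2 ^ max p N := Nat.lt_two_pow_self
  refine ⟨i₀ + 2 ^ max p N, by omega, hr (Sum.inl (R.vert (i₀ + 2 ^ max p N))) (Sum.inr η) _ rfl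
    R.vert ⟨R, hη, rfl⟩ (i₀ + 2 ^ max p N) (fun _ _ => hi₀ _ (Nat.le_add_right _ _))
    (fun j hj => hi₀ j (by omega)) ?_⟩
  intro _ _ j hj n g hg t ht
  refine hp (max p N) (le_max_left _ _) (j - i₀) (by omega) n g ?_ t ht
  rwa [show i₀ + (j - i₀) = j by omega]

/-- Vertices that leave the balls around `o` inside the strong component of `o` accumulate at a
boundary point, which belongs to the end they are attached to. -/
theorem exists_boundary_limit (hL : StepSystem (Within (V := V))) (hk : Thin (Within (V := V)) k)
    (hF : Reversible (Within (V := V)) F) {ε : ℝ} (hε : 0 < ε) (S : Finset V) {R₁ : Ray V}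
    {v : ℕ → V} (hv : ∀ n, Strong Within o (v n))
    (hchain : ∀ r, ∀ᶠ n in atTop, ∃ i, Far Within o r (R₁.vert i) ∧
      Relation.ReflTransGen (FarStep Within o r) (R₁.vert i) (v n))
    (hfar : ∀ r, ∀ᶠ n in atTop, ¬ Mut Within r o (v n)) :
    ∃ (R : Ray V) (hR : R.IsQuasiGeodesic), EndEquiv R₁ R ∧ ∀ e : ℝ≥0∞, 0 < e →
      ∃ᶠ n in atTop, visualDist ε S (Sum.inl (v n)) (Sum.inr (R.toBoundary hR)) < e ∧
        visualDist ε S (Sum.inr (R.toBoundary hR)) (Sum.inl (v n)) < e := by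
  choose l G hG h0 h1 using fun n => hL.exists_geo (hv n).1
  -- An out-ball of radius `r` lies, within the component, in the mutual ball of radius `F r`.
  obtain ⟨Q, hQ, rfl, hlim⟩ := hL.exists_limit (fun r => (hfar (F r)).mono fun n hn h =>
    hn (hF _ _ _ h (hv n).2)) hG h0 h1
  have hGs : ∀ n, Strong Within (G n 0) (G n (l n)) := fun n => by
    rw [h0, h1]
    exact hv n
  have hQs : ∀ m, Strong Within (Q 0) (Q m) := fun m => by
    obtain ⟨n, hn, hs⟩ := (hlim m).exists
    rw [← hs m le_rfl, ← h0 n]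
    exact (hG n).strong hL (Strong.refl hL _) (hGs n) hn
  obtain ⟨R, rfl, hR⟩ := exists_ray_of_geodesic hL hQ
  refine ⟨R, hR, ?_, fun e he => ?_⟩
  · have key : ∀ A : Set V, A.Finite → ∃ i j, (R₁.vert i ∉ A ∧ R.vert j ∉ A) ∧
        Conn Within A (R₁.vert i) (R.vert j) ∧ Conn Within A (R.vert j) (R₁.vert i) := by
      intro A hA
      obtain ⟨r, hr, hrc⟩ := exists_far_conn hL hF (R.vert 0) hA
      obtain ⟨n, ⟨hn, hs⟩, i, hi, hc⟩ :=
        ((hlim (r + 1)).and (Nat.hyperfilter_le_atTop (hchain r))).exists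
      have hc' := (hG n).farChain hL (hGs n) r.lt_succ_self hn le_rfl
      rw [h1, h0, hs _ le_rfl] at hc'
      have hRfar : Far Within (R.vert 0) r (R.vert (r + 1)) := ⟨hQs _, fun h => by
        have := (hQ (r + 1)).le hL (Nat.zero_le _) le_rfl h.1
        omega⟩
      exact ⟨i, r + 1, ⟨hr _ hi, hr _ hRfar⟩, hrc _ _ (hc.trans (FarStep.chain_symm hc')),
        hrc _ _ (hc'.trans (FarStep.chain_symm hc))⟩
    exact ⟨endLE_iff.2 fun A hA => let ⟨i, j, h, h', _⟩ := key A hA; ⟨i, j, h.1, h'⟩,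
      endLE_iff.2 fun A hA => let ⟨i, j, h, _, h'⟩ := key A hA; ⟨j, i, h.2, h'⟩⟩
  · obtain ⟨r, hr⟩ := exists_far_visualDist_lt hL hε S (R.vert 0) he
    -- Convergence along an ultrafilter finer than `atTop` gives infinitely many good `n`, not all
    -- large ones.
    refine Frequently.filter_mono (Eventually.frequently ?_) Nat.hyperfilter_le_atTop
    filter_upwards [hlim (r + F k + 1)] with n hn
    refine hr (Sum.inl (v n)) (Sum.inr (R.toBoundary hR)) _ rfl R.vert
      ⟨R, Ray.mem_toBoundary hL hR, rfl⟩ (r + F k + 1) (fun _ _ => hv n) (fun j _ => hQs j) ?_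
    intro _ _ j hj m w hw t ht
    rw [← h1 n] at hw
    exact far_of_common_start hL hk hF hQ hQs (hG n) (by rw [h1]; exact hv n) hn.1 hn.2
      (Nat.lt_succ_self _) hj hw ht

theorem exists_equiv_quasiGeodesic_of_strong (hL : StepSystem (Within (V := V)))
    (hk : Thin (Within (V := V)) k) (hF : Reversible (Within (V := V)) F) {R₀ : Ray V}
    (ho : ∀ᶠ i in atTop, Strong Within o (R₀.vert i)) :
    ∃ R : Ray V, R.IsQuasiGeodesic ∧ EndEquiv R₀ R := by
  obtain ⟨i₀, hi₀⟩ := eventually_atTop.1 ho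
  have hfar : ∀ r, ∀ᶠ n in atTop, Far Within o r (R₀.vert (i₀ + n)) := fun r =>
    (tendsto_add_atTop_nat i₀).eventually (R₀.eventually_far hL ho r) |>.mono fun n h => by
      rwa [add_comm]
  -- Only the equivalence of the rays is used, so the visual parameters are arbitrary.
  obtain ⟨R, hR, hR', -⟩ := exists_boundary_limit hL hk hF one_pos ∅ (R₁ := R₀)
    (fun n => hi₀ (i₀ + n) (Nat.le_add_right _ _))
    (fun r => (hfar r).mono fun n hn => ⟨_, hn, .refl⟩) fun r => (hfar r).mono fun n hn => hn.2
  exact ⟨R, hR, hR'⟩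

theorem _root_.Relation.ReflTransGen.exists_step {α : Type*} {r : α → α → Prop} {P : α → Prop}
    {a b : α} (h : Relation.ReflTransGen r a b) (ha : P a) (hb : ¬ P b) :
    ∃ c d, Relation.ReflTransGen r a c ∧ r c d ∧ P c ∧ ¬ P d := by
  induction h with
  | refl => exact absurd ha hb
  | @tail c d hac hcd ih =>
    by_cases hc : P c
    · exact ⟨c, d, hac, hcd, hc, hb⟩
    · exact ih hc

/-- Two rays of the same end with their tails in a strong component are joined by far chains whose
first and last vertices are close to given boundary points. -/
theorem exists_farChain_between (hL : StepSystem (Within (V := V)))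
    (hk : Thin (Within (V := V)) k) (hF : Reversible (Within (V := V)) F) {ε : ℝ} (hε : 0 < ε)
    (S : Finset V) {R₁ R₂ : Ray V} (hR₁ : R₁.IsQuasiGeodesic) (hR₂ : R₂.IsQuasiGeodesic)
    (h₁ : ∀ᶠ i in atTop, Strong Within o (R₁.vert i))
    (h₂ : ∀ᶠ i in atTop, Strong Within o (R₂.vert i)) (h₁₂ : EndLE R₁ R₂) {η μ : Boundary V}
    (hη : R₁ ∈ η.1) (hμ : R₂ ∈ μ.1) {e : ℝ≥0∞} (he : 0 < e) (r : ℕ) :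
    ∃ i j, Far Within o r (R₁.vert i) ∧
      Relation.ReflTransGen (FarStep Within o r) (R₁.vert i) (R₂.vert j) ∧
      (visualDist ε S (Sum.inl (R₁.vert i)) (Sum.inr η) < e ∧
        visualDist ε S (Sum.inr η) (Sum.inl (R₁.vert i)) < e) ∧
      visualDist ε S (Sum.inl (R₂.vert j)) (Sum.inr μ) < e ∧
        visualDist ε S (Sum.inr μ) (Sum.inl (R₂.vert j)) < e := by
  obtain ⟨N₁, hN₁⟩ := eventually_atTop.1 (R₁.eventually_far hL h₁ r)
  obtain ⟨N₂, hN₂⟩ := eventually_atTop.1 (R₂.eventually_far hL h₂ r)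
  obtain ⟨i, hi, hiη⟩ := exists_vert_close hL hk hF hε S hR₁ h₁ hη he N₁
  obtain ⟨j, hj, hjμ⟩ := exists_vert_close hL hk hF hε S hR₂ h₂ hμ he N₂
  have hfin : {v | Mut Within r o v}.Finite := (hL.finite_out r o).subset fun v hv => hv.1
  -- The crossing walk starts and ends beyond both `i` and `j`, so it is attached to them along far
  -- pieces of the rays.
  obtain ⟨i', hi', j', hj', -, hc⟩ := h₁₂.exists_conn hfin (max i j)
  refine ⟨i, j, hN₁ i hi, ?_, hiη, hjμ⟩
  have c1 := R₁.farChain hN₁ hi ((le_max_left i j).trans hi')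
  have c2 := R₂.farChain hN₂ hj ((le_max_right i j).trans hj')
  have c3 := hc.farChain hL (hN₁ i' (hi.trans ((le_max_left i j).trans hi'))).1.1
    (hN₂ j' (hj.trans ((le_max_right i j).trans hj'))).1
  exact (c1.trans c3).trans (FarStep.chain_symm c2)

theorem isSemiconnected_pointsIn_of_strong (hL : StepSystem (Within (V := V)))
    (hk : Thin (Within (V := V)) k) (hF : Reversible (Within (V := V)) F) {ε : ℝ} (hε : 0 < ε)
    (S : Finset V) (hsemi : Semimetric.IsSemimetric (visualDist ε S)) {R₀ : Ray V}
    (ho : ∀ᶠ i in atTop, Strong Within o (R₀.vert i)) :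
    Semimetric.IsSemiconnected (boundaryDist ε S) (pointsIn {R' | EndEquiv R₀ R'}) := by
  have htri := hsemi.2
  rw [Semimetric.isSemiconnected_iff (d := boundaryDist ε S) (fun x => (hsemi.1 _ _).2 rfl)
    fun x y z => htri _ _ _]
  intro T hT hT'
  by_contra hcon
  obtain ⟨h1, h2⟩ := not_or.1 hcon
  obtain ⟨μ, hμ, hμT⟩ := Set.not_subset.1 h1
  obtain ⟨η, hη, hηT⟩ := Set.not_subset.1 h2
  rw [Set.mem_compl_iff, not_not] at hηT
  obtain ⟨R₁, hR₁η, hR₁, hR₁e⟩ := exists_ray_of_mem_pointsIn hL hη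
  obtain ⟨R₂, hR₂μ, hR₂, hR₂e⟩ := exists_ray_of_mem_pointsIn hL hμ
  have hs₁ := hR₁e.1.reachLE.eventually_strong hL hR₁e.2.reachLE ho
  have hs₂ := hR₂e.1.reachLE.eventually_strong hL hR₂e.2.reachLE ho
  set C := pointsIn {R' | EndEquiv R₀ R'} with hC
  let D := visualDist ε S
  let DU : V → ℝ≥0∞ := fun z => ⨅ u ∈ C ∩ T, D (Sum.inl z) (Sum.inr u)
  let DW : V → ℝ≥0∞ := fun z => ⨅ w ∈ C ∩ Tᶜ, D (Sum.inl z) (Sum.inr w)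
  have hDU : ∀ z, ∀ u ∈ C ∩ T, DU z ≤ D (Sum.inl z) (Sum.inr u) := fun z u hu => iInf₂_le u hu
  have hDW : ∀ z, ∀ w ∈ C ∩ Tᶜ, DW z ≤ D (Sum.inl z) (Sum.inr w) := fun z w hw => iInf₂_le w hw
  have hexU : ∀ {z e}, DU z < e → ∃ u ∈ C ∩ T, D (Sum.inl z) (Sum.inr u) < e := fun h => by
    simpa only [DU, iInf_lt_iff, exists_prop] using h
  have hexW : ∀ {z e}, DW z < e → ∃ w ∈ C ∩ Tᶜ, D (Sum.inl z) (Sum.inr w) < e := fun h => by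
    simpa only [DW, iInf_lt_iff, exists_prop] using h
  have hstep : ∀ n : ℕ, ∃ i z z', Far Within o n (R₁.vert i) ∧
      Relation.ReflTransGen (FarStep Within o n) (R₁.vert i) z ∧ FarStep Within o n z z' ∧
      DU z < DW z ∧ ¬ DU z' < DW z' := by
    intro n
    obtain ⟨e₁, he₁, hb₁⟩ := hT η hη hηT
    obtain ⟨e₂, he₂, hb₂⟩ := hT' μ hμ hμT
    have he : 0 < min e₁ e₂ / 2 := ENNReal.half_pos (lt_min he₁ he₂).ne'
    have hadd := ENNReal.add_halves (min e₁ e₂)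
    generalize min e₁ e₂ / 2 = e at he hadd
    obtain ⟨i, j, hi, hc, ⟨hi1, hi2⟩, hj1, hj2⟩ := exists_farChain_between hL hk hF hε S hR₁ hR₂
      hs₁ hs₂ (hR₁e.symm.trans hR₂e).1 hR₁η hR₂μ he n
    have hP : DU (R₁.vert i) < DW (R₁.vert i) := by
      refine ((hDU _ η ⟨hη, hηT⟩).trans_lt hi1).trans_le (le_of_not_gt fun hlt => ?_)
      obtain ⟨w, hw, hlt⟩ := hexW hlt
      refine hw.2 (hb₁ w hw.1 (Or.inl (lt_of_lt_of_le ?_ (min_le_left e₁ e₂))))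
      rw [← hadd]
      exact (htri _ _ (Sum.inl (R₁.vert i))).trans_lt (ENNReal.add_lt_add hi2 hlt)
    have hP' : ¬ DU (R₂.vert j) < DW (R₂.vert j) := by
      refine (((hDW _ μ ⟨hμ, hμT⟩).trans_lt hj1).le.trans (le_of_not_gt fun hlt => ?_)).not_gt
      obtain ⟨u, hu, hlt⟩ := hexU hlt
      refine hb₂ u hu.1 (Or.inl (lt_of_lt_of_le ?_ (min_le_right e₁ e₂))) hu.2
      rw [← hadd]
      exact (htri _ _ (Sum.inl (R₂.vert j))).trans_lt (ENNReal.add_lt_add hj2 hlt)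
    -- The switching step of the chain, from nearer to `T` to not nearer.
    obtain ⟨z, z', hz, hzz', hPz, hPz'⟩ := hc.exists_step (P := fun z => DU z < DW z) hP hP'
    exact ⟨i, z, z', hi, hz, hzz', hPz, hPz'⟩
  choose i z z' hi hz hzz' hPz hPz' using hstep
  obtain ⟨R, hR, hR₁R, hlim⟩ := exists_boundary_limit hL hk hF hε S (R₁ := R₁) (v := z)
    (fun n => (hzz' n).2.1.1)
    (fun r => (eventually_ge_atTop r).mono fun n hn => ⟨i n, (hi n).mono hL hn,
      Relation.ReflTransGen.mono (fun _ _ => FarStep.mono hL hn) _ _ (hz n)⟩)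
    (fun r => (eventually_ge_atTop r).mono fun n hn => ((hzz' n).2.1.mono hL hn).2)
  have hRC : R.toBoundary hR ∈ C := Ray.toBoundary_mem_pointsIn hL hR (hR₁e.trans hR₁R)
  generalize R.toBoundary hR = ξ at hlim hRC
  by_cases hξ : ξ ∈ T
  · obtain ⟨e₀, he₀, hb⟩ := hT ξ hRC hξ
    -- Quarters of `e₀`: the ways from `ξ` to `z n` and on to `z' n` cost less than `e` each, and
    -- some `w` outside `T` has distance less than `e + e` from `z' n`, since `ξ` does.
    have he : 0 < e₀ / 2 / 2 := ENNReal.half_pos (ENNReal.half_pos he₀.ne').ne'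
    have hadd := ENNReal.add_halves (e₀ / 2)
    have hadd' := ENNReal.add_halves e₀
    generalize e₀ / 2 / 2 = e at he hadd
    rw [← hadd] at hadd'
    obtain ⟨r, hr⟩ := exists_farStep_visualDist_lt hL hF hε S o he
    obtain ⟨n, ⟨hn1, hn2⟩, hnr⟩ := ((hlim e he).and_eventually (eventually_ge_atTop r)).exists
    obtain ⟨hr1, hr2⟩ := hr _ _ ((hzz' n).mono hL hnr)
    have hz'ξ : D (Sum.inl (z' n)) (Sum.inr ξ) < e + e :=
      (htri _ _ (Sum.inl (z n))).trans_lt (ENNReal.add_lt_add hr2 hn1)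
    obtain ⟨w, hw, hlt⟩ := hexW
      (((not_lt.1 (hPz' n)).trans (hDU _ ξ ⟨hRC, hξ⟩)).trans_lt hz'ξ)
    refine hw.2 (hb w hw.1 (Or.inl ?_))
    rw [← hadd']
    refine (htri _ _ (Sum.inl (z' n))).trans_lt (ENNReal.add_lt_add ?_ hlt)
    exact (htri _ _ (Sum.inl (z n))).trans_lt (ENNReal.add_lt_add hn2 hr1)
  · obtain ⟨e₀, he₀, hb⟩ := hT' ξ hRC hξ
    have he : 0 < e₀ / 2 := ENNReal.half_pos he₀.ne'
    have hadd := ENNReal.add_halves e₀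
    generalize e₀ / 2 = e at he hadd
    obtain ⟨n, hn1, hn2⟩ := (hlim e he).exists
    -- Since `z n` is nearer to `T` than to `ξ`, a point of `T` is close to `ξ`.
    obtain ⟨u, hu, hlt⟩ := hexU (((hPz n).trans_le (hDW _ ξ ⟨hRC, hξ⟩)).trans hn1)
    refine hb u hu.1 (Or.inl ?_) hu.2
    rw [← hadd]
    exact (htri _ _ (Sum.inl (z n))).trans_lt (ENNReal.add_lt_add hn2 hlt)

end

end HypDigraph

/-! ### Conclusion for both kinds of ends -/

theorem mainTheorem10 {V : Type*} [Quiver V] (δ : ℝ) (hδ : 0 ≤ δ)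
    (hfin : HypDigraph.LocallyFinite V) (hhyp : HypDigraph.IsHyperbolic V δ)
    (f : ℝ → ℝ) (hB1 : HypDigraph.SatisfiesB1 V f) (hB2 : HypDigraph.SatisfiesB2 V f)
    (S : Finset V) (hS : HypDigraph.IsBase S) (ε : ℝ) (hε : 0 < ε)
    (hε' : Real.exp (2 * ε * (6 * δ + 2 * δ * f (δ + 1))) < Real.sqrt 2)
    (hsemi : Semimetric.IsSemimetric (HypDigraph.visualDist ε S))
    (ω : Set (HypDigraph.Ray V)) (hω : ω ∈ HypDigraph.ends V) :
    ∃! C : Set (HypDigraph.Boundary V),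
      Semimetric.IsSemiconnectedComponent (HypDigraph.boundaryDist ε S) C ∧
        HypDigraph.pointsIn ω ⊆ C := by
  obtain ⟨R₀, rfl⟩ := hω
  have hL := HypDigraph.stepSystem_within hfin
  have hk := hhyp.thin hL
  have hF := hB1.reversible hL
  have h0 : ∀ x, HypDigraph.boundaryDist ε S x x = 0 := fun x => (hsemi.1 _ _).2 rfl
  have htri : ∀ x y z, HypDigraph.boundaryDist ε S x y ≤
      HypDigraph.boundaryDist ε S x z + HypDigraph.boundaryDist ε S z y :=
    fun x y z => hsemi.2 _ _ _
  by_cases ho : ∃ o, ∀ᶠ i in Filter.atTop, HypDigraph.Strong HypDigraph.Within o (R₀.vert i)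
  · obtain ⟨o, ho⟩ := ho
    obtain ⟨R, hR, hR₀⟩ := HypDigraph.exists_equiv_quasiGeodesic_of_strong hL hk hF ho
    exact Semimetric.existsUnique_semiconnectedComponent h0 htri
      (HypDigraph.isSemiconnected_pointsIn_of_strong hL hk hF hε S hsemi ho)
      ⟨_, HypDigraph.Ray.toBoundary_mem_pointsIn hL hR hR₀⟩
  · obtain ⟨R, hR, hR₀⟩ := HypDigraph.exists_equiv_quasiGeodesic_of_no_strong hL hk ho
    refine Semimetric.existsUnique_semiconnectedComponent h0 htri ?_
      ⟨_, HypDigraph.Ray.toBoundary_mem_pointsIn hL hR hR₀⟩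
    have hsub := HypDigraph.pointsIn_subsingleton_of_no_strong hL hε S
      (fun x y => (hsemi.1 x y).1) ho
    rw [Semimetric.isSemiconnected_iff h0 htri]
    intro T _ _
    by_contra hcon
    obtain ⟨h1, h2⟩ := not_or.1 hcon
    obtain ⟨x, hx, hxT⟩ := Set.not_subset.1 h1
    obtain ⟨y, hy, hyT⟩ := Set.not_subset.1 h2
    exact hyT (hsub hx hy ▸ hxT)
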